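/- Let $n,m\ge 0$ be integers, and let $\mathbb{R}^n,\mathbb{R}^m$ carry their Euclidean inner products and norms. Let $q_k(x)=\tfrac12\langle x,A_kx\rangle-\langle b_k,x\rangle+c_k$ $(k=0,1,\dots,m)$ be quadratic functions on $\mathbb{R}^n$, with $A_k$ real symmetric $n\times n$ matrices, $b_k\in\mathbb{R}^n$, $c_k\in\mathbb{R}$; put $q:=(q_1,\dots,q_m)$ and, for $\sigma\in\mathbb{R}^m$, $A(\sigma):=A_0+\sum_{i=1}^m\sigma_iA_i$, $b(\sigma):=b_0+\sum_{i=1}^m\sigma_ib_i$. Let $V:\mathbb{R}^m\to\mathbb{R}\cup\{+\infty\}$ be a proper convex lower semicontinuous function of Legendre type (that is, essentially smooth and essentially strictly convex) which is twice differentiable on $\operatorname{int}(\operatorname{dom}V)$ with $\nabla^2V(y)\succ0$ for every $y\in\operatorname{int}(\operatorname{dom}V)$, where $\operatorname{dom}V:=\{y\mid V(y)<\infty\}$. Let $V^*(\sigma):=\sup_{y}\,[\langle y,\sigma\rangle-V(y)]$ be its Fenchel conjugate, and put $$f(x):=q_0(x)+V(q(x)),\qquad \Xi(x,\sigma):=q_0(x)+\langle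 q(x),\sigma\rangle-V^*(\sigma)\qquad(x\in\mathbb{R}^n,\ \sigma\in\mathbb{R}^m).$$ Let $S_{\mathrm{col}}:=\{\sigma\in\operatorname{dom}V^*\mid b(\sigma)\in\operatorname{Im}A(\sigma)\}$ and let $D:S_{\mathrm{col}}\to\mathbb{R}$ be the dual function $D(\sigma):=\Xi(x,\sigma)$ for any $x$ with $A(\sigma)x=b(\sigma)$ (the value does not depend on the choice of $x$). Let $\overline{x}\in\mathbb{R}^n$ and $\overline\sigma\in\operatorname{dom}V^*$ be such that $q(\overline{x})\in\operatorname{int}(\operatorname{dom}V)$, $A(\overline\sigma)\prec0$, and $(\overline{x},\overline\sigma)$ is a critical point of $\Xi$, i.e. $\Xi$ is finite near $(\overline{x},\overline\sigma)$, differentiable there, and $\nabla\Xi(\overline{x},\overline\sigma)=0$. Assume that $\det\nabla^2f(\overline{x})\ne0$. Let $E\in\mathbb{R}^{n\times n}$ and $F\in\mathbb{R}^{m\times m}$ be any matrices with $E^{T}E=-A(\overline\sigma)$ and $F^{T}F=\nabla^2V(q(\overline{x}))$ (they are necessarily non-singular), let $d_i:=(E^{-1})^{T}(A_i\overline{x}-b_i)\in\mathbb{R}^n$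 for $i=1,\dots,m$, let $J:\mathbb{R}^m\to\mathbb{R}^n$, $Jv:=\sum_{i=1}^mv_id_i$, and let $H:=J\circ F^{T}:\mathbb{R}^m\to\mathbb{R}^n$. Let $S_m:=\{v\in\mathbb{R}^m\mid\|v\|=1\}$. Then: (a) $\overline{x}$ is a local maximizer of $f$ if and only if $\|Hv\|<1$ for all $v\in S_m$, if and only if $\overline\sigma$ is a local maximizer of $D$ (on $S_{\mathrm{col}}$). (b) Assume that $m=n$. Then $\overline{x}$ is a local minimizer of $f$ if and only if $\|Hv\|>1$ for all $v\in S_m$, if and only if $\overline\sigma$ is a local minimizer of $D$ (on $S_{\mathrm{col}}$). -/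

import Mathlib

open scoped Matrix Topology

noncomputable section

namespace CanonicalDuality

/-! ### Extended-real-valued convex functions -/

section Convex

variable {E : Type*} [NormedAddCommGroup E] [InnerProductSpace ℝ E]

/-- The effective domain `{y | g y < ∞}`. -/
def edom (g : E → EReal) : Set E := {y | g y < ⊤}

/-- The class `Γ` of proper convex lower semicontinuous functions. For a proper function, convexity
is convexity of its domain together with convexity of its (finite) restriction to the domain. -/
structure IsGamma (g : E → EReal) : Prop where
  nonempty : (edom g).Nonempty
  ne_bot : ∀ y, g y ≠ ⊥
  convex : ConvexOn ℝ (edom g) (fun y => (g y).toReal)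
  lsc : LowerSemicontinuous g

/-- The Fenchel conjugate `g*(σ) = sup_y (⟨y, σ⟩ - g y)`. -/
def conj (g : E → EReal) (σ : E) : EReal := ⨆ y : E, ((inner ℝ y σ : ℝ) : EReal) - g y

/-- The convex subdifferential; it is empty outside the domain. -/
def subdiff (g : E → EReal) (y : E) : Set E :=
  {σ | y ∈ edom g ∧ ∀ y', ((inner ℝ (y' - y) σ : ℝ) : EReal) ≤ g y' - g y}

/-- Essential smoothness: the interior of the domain is nonempty, `g` is differentiable there, and
the norm of the derivative tends to `∞` at every boundary point of the interior of the domain. -/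
structure IsEssentiallySmooth (g : E → EReal) : Prop where
  nonempty_interior : (interior (edom g)).Nonempty
  differentiableOn : DifferentiableOn ℝ (fun y => (g y).toReal) (interior (edom g))
  tendsto_norm : ∀ y ∈ frontier (interior (edom g)),
    Filter.Tendsto (fun z => ‖fderiv ℝ (fun w => (g w).toReal) z‖) (𝓝[interior (edom g)] y)
      Filter.atTop

/-- Essential strict convexity: strict convexity on every convex subset of the domain
`{y | ∂g(y) ≠ ∅}` of the subdifferential. -/
def IsEssentiallyStrictlyConvex (g : E → EReal) : Prop :=
  ∀ C : Set E, Convex ℝ C → (∀ y ∈ C, (subdiff g y).Nonempty) →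
    StrictConvexOn ℝ C (fun y => (g y).toReal)

/-- The class `Γ_sc` of proper lower semicontinuous convex functions of Legendre type. -/
structure IsGammaSC (g : E → EReal) : Prop extends IsGamma g where
  essentiallySmooth : IsEssentiallySmooth g
  essentiallyStrictlyConvex : IsEssentiallyStrictlyConvex g

end Convex

/-- A critical point of an extended-real-valued function: the function is finite near the point,
differentiable at it, and its derivative there vanishes. -/
def IsCriticalPoint {E : Type*} [NormedAddCommGroup E] [NormedSpace ℝ E] (g : E → EReal) (z : E) :
    Prop :=
  (∀ᶠ w in 𝓝 z, g w ≠ ⊤ ∧ g w ≠ ⊥) ∧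
    HasFDerivAt (fun w => (g w).toReal) (0 : E →L[ℝ] ℝ) z

/-- The Hessian matrix of a real function on `ℝᵏ`. -/
def hessian {k : ℕ} (g : EuclideanSpace ℝ (Fin k) → ℝ) (x : EuclideanSpace ℝ (Fin k)) :
    Matrix (Fin k) (Fin k) ℝ :=
  Matrix.of fun i j =>
    fderiv ℝ (fderiv ℝ g) x (EuclideanSpace.single i 1) (EuclideanSpace.single j 1)

/-- The class `Γ²_sc`: functions in `Γ_sc` that are twice differentiable on the interior of their
domain, with positive definite Hessian there. -/
structure IsGammaSC2 {m : ℕ} (g : EuclideanSpace ℝ (Fin m) → EReal) : Prop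
    extends IsGammaSC g where
  twice_differentiable : ∀ y ∈ interior (edom g),
    DifferentiableAt ℝ (fderiv ℝ (fun w => (g w).toReal)) y
  hessian_posDef : ∀ y ∈ interior (edom g), (hessian (fun w => (g w).toReal) y).PosDef

/-! ### Quadratic functions, primal, Lagrangian-type and dual functions -/

/-- The coefficients of quadratic functions `q₀, q₁, …, q_m` on `ℝⁿ`,
`q_k(x) = ½⟨x, A_k x⟩ - ⟨b_k, x⟩ + c_k` with `A_k` symmetric. -/
structure QuadFamily (n m : ℕ) where
  A : Fin (m + 1) → Matrix (Fin n) (Fin n) ℝ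
  b : Fin (m + 1) → EuclideanSpace ℝ (Fin n)
  c : Fin (m + 1) → ℝ
  symm : ∀ k, (A k).IsSymm

namespace QuadFamily

variable {n m : ℕ} (Q : QuadFamily n m)

/-- The quadratic function `q_k`. -/
def quad (k : Fin (m + 1)) (x : EuclideanSpace ℝ (Fin n)) : ℝ :=
  1 / 2 * inner ℝ x (Matrix.toEuclideanLin (Q.A k) x) - inner ℝ (Q.b k) x + Q.c k

/-- The map `q = (q₁, …, q_m) : ℝⁿ → ℝᵐ`. -/
def q (x : EuclideanSpace ℝ (Fin n)) : EuclideanSpace ℝ (Fin m) :=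
  WithLp.toLp 2 fun i => Q.quad i.succ x

/-- `A(σ) = A₀ + ∑ σ_i A_i`. -/
def Aσ (σ : EuclideanSpace ℝ (Fin m)) : Matrix (Fin n) (Fin n) ℝ :=
  Q.A 0 + ∑ i : Fin m, σ i • Q.A i.succ

/-- `b(σ) = b₀ + ∑ σ_i b_i`. -/
def bσ (σ : EuclideanSpace ℝ (Fin m)) : EuclideanSpace ℝ (Fin n) :=
  Q.b 0 + ∑ i : Fin m, σ i • Q.b i.succ

/-- The primal objective `f = q₀ + V ∘ q`. -/
def f (V : EuclideanSpace ℝ (Fin m) → EReal) (x : EuclideanSpace ℝ (Fin n)) : EReal :=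
  (Q.quad 0 x : EReal) + V (Q.q x)

/-- The Lagrangian `L(x, σ) = q₀(x) + ⟨q(x), σ⟩`. -/
def L (x : EuclideanSpace ℝ (Fin n)) (σ : EuclideanSpace ℝ (Fin m)) : ℝ :=
  Q.quad 0 x + inner ℝ (Q.q x) σ

/-- The total complementary function `Ξ(x, σ) = L(x, σ) - V*(σ)`. -/
def Xi (V : EuclideanSpace ℝ (Fin m) → EReal)
    (p : EuclideanSpace ℝ (Fin n) × EuclideanSpace ℝ (Fin m)) : EReal :=
  (Q.L p.1 p.2 : EReal) - conj V p.2

/-- `X₀ = {x | q(x) ∈ int (dom V)}`. -/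
def X0 (V : EuclideanSpace ℝ (Fin m) → EReal) : Set (EuclideanSpace ℝ (Fin n)) :=
  {x | Q.q x ∈ interior (edom V)}

/-- `S⁻ = {σ ∈ dom V* | A(σ) ≺ 0}`. -/
def Sneg (V : EuclideanSpace ℝ (Fin m) → EReal) : Set (EuclideanSpace ℝ (Fin m)) :=
  {σ | (-Q.Aσ σ).PosDef} ∩ edom (conj V)

/-- `S_col = {σ ∈ dom V* | b(σ) ∈ Im A(σ)}`, the set on which the dual function is defined. -/
def Scol (V : EuclideanSpace ℝ (Fin m) → EReal) : Set (EuclideanSpace ℝ (Fin m)) :=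
  {σ | ∃ x, Matrix.toEuclideanLin (Q.Aσ σ) x = Q.bσ σ} ∩ edom (conj V)

open Classical in
/-- The dual function `D(σ) = Ξ(x, σ)` for any `x` with `A(σ) x = b(σ)`; see `D_eq` for the
independence of the choice of `x`. Its values outside `S_col` are irrelevant. -/
def D (V : EuclideanSpace ℝ (Fin m) → EReal) (σ : EuclideanSpace ℝ (Fin m)) : EReal :=
  if h : ∃ x, Matrix.toEuclideanLin (Q.Aσ σ) x = Q.bσ σ then Q.Xi V (h.choose, σ) else ⊥

theorem L_eq (x : EuclideanSpace ℝ (Fin n)) (σ : EuclideanSpace ℝ (Fin m)) :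
    Q.L x σ = 1 / 2 * inner ℝ x (Matrix.toEuclideanLin (Q.Aσ σ) x) - inner ℝ (Q.bσ σ) x
      + (Q.c 0 + ∑ i : Fin m, σ i * Q.c i.succ) := by
  have h : inner ℝ (Q.q x) σ = ∑ i : Fin m, σ i * Q.quad i.succ x := by
    simp [q, PiLp.inner_apply]
  rw [L, h]
  simp only [quad, Aσ, bσ, map_add, map_sum, map_smul, LinearMap.add_apply, LinearMap.sum_apply,
    LinearMap.smul_apply, inner_add_right, inner_add_left, inner_sum, sum_inner,
    real_inner_smul_left, real_inner_smul_right, mul_add, mul_sub, Finset.sum_add_distrib,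
    Finset.sum_sub_distrib, Finset.mul_sum]
  have h2 : ∀ i : Fin m, σ i * (1 / 2 * inner ℝ x (Matrix.toEuclideanLin (Q.A i.succ) x))
      = 1 / 2 * (σ i * inner ℝ x (Matrix.toEuclideanLin (Q.A i.succ) x)) := fun i => by ring
  simp only [h2]
  ring

theorem Aσ_isSymm (σ : EuclideanSpace ℝ (Fin m)) : (Q.Aσ σ).IsSymm := by
  simp only [Matrix.IsSymm, Aσ, Matrix.transpose_add, Matrix.transpose_sum, Matrix.transpose_smul,
    (Q.symm _).eq]

theorem D_eq (V : EuclideanSpace ℝ (Fin m) → EReal) {σ : EuclideanSpace ℝ (Fin m)}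
    {x : EuclideanSpace ℝ (Fin n)} (hx : Matrix.toEuclideanLin (Q.Aσ σ) x = Q.bσ σ) :
    Q.D V σ = Q.Xi V (x, σ) := by
  have h : ∃ x, Matrix.toEuclideanLin (Q.Aσ σ) x = Q.bσ σ := ⟨x, hx⟩
  have hy := h.choose_spec
  have hs : (Matrix.toEuclideanLin (Q.Aσ σ)).IsSymmetric :=
    Matrix.isSymmetric_toEuclideanLin_iff.2 (by
      rw [Matrix.IsHermitian, Matrix.conjTranspose_eq_transpose_of_trivial]
      exact Q.Aσ_isSymm σ)
  rw [D, dif_pos h]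
  set y := h.choose
  have e : inner ℝ y (Q.bσ σ) = inner ℝ x (Q.bσ σ) := by
    conv_lhs => rw [← hx, ← hs, hy, real_inner_comm]
  simp only [Xi, L_eq, hx, hy, e, real_inner_comm _ (Q.bσ σ)]

/-- `d_i = (E⁻¹)* (A_i x - b_i)`. -/
def d (E : Matrix (Fin n) (Fin n) ℝ) (x : EuclideanSpace ℝ (Fin n)) (i : Fin m) :
    EuclideanSpace ℝ (Fin n) :=
  Matrix.toEuclideanLin (E⁻¹)ᵀ (Matrix.toEuclideanLin (Q.A i.succ) x - Q.b i.succ)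

/-- `J v = ∑ v_i d_i`. -/
def J (E : Matrix (Fin n) (Fin n) ℝ) (x : EuclideanSpace ℝ (Fin n)) :
    EuclideanSpace ℝ (Fin m) →ₗ[ℝ] EuclideanSpace ℝ (Fin n) where
  toFun v := ∑ i : Fin m, v i • Q.d E x i
  map_add' u v := by simp [add_smul, Finset.sum_add_distrib]
  map_smul' r v := by simp [mul_smul, Finset.smul_sum]

/-- `H = J ∘ F*`. -/
def H (E : Matrix (Fin n) (Fin n) ℝ) (F : Matrix (Fin m) (Fin m) ℝ)
    (x : EuclideanSpace ℝ (Fin n)) : EuclideanSpace ℝ (Fin m) →ₗ[ℝ] EuclideanSpace ℝ (Fin n) :=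
  Q.J E x ∘ₗ Matrix.toEuclideanLin Fᵀ

end QuadFamily

end CanonicalDuality

end

/-! Both extremality questions reduce to definiteness of a quadratic form built from `H`. At a
critical point, `V*` has gradient `q(x)` at `σ`, which forces `∇V(q(x)) = σ`
(`gradient_conj_gradient`). The chain rule then gives `∇²f(x) = A(σ) + Dqᵀ ∇²V Dq = Eᵀ(H Hᵀ - 1)E`,
so `f` has second-order form `‖Hᵀw‖² - ‖w‖²` with `w = Eu` (`primal_expansion`).

On the dual side, the solution of `A(σ+h)z = b(σ+h)` can be written out and substituted in `Ξ`. `V*`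
has second-order form `‖F⁻ᵀh‖²`, obtained directly from the supremum and the convexity of `V`
(`conj_isLittleO`). Hence `D` has second-order form `‖Hv‖² - ‖v‖²` with `h = Fᵀv`
(`dual_isLittleO`).

A local extremum makes its form semidefinite, and a definite form gives an extremum. Since `∇²f(x)`
is nonsingular, 1 is not an eigenvalue of `H Hᵀ`, hence not of `Hᵀ H`, so semidefinite already means
definite. Finally, `H` is strictly contracting iff `Hᵀ` is; for strict expansion this transfer uses
`m = n`. -/

namespace CanonicalDuality

/-! ### Strict contraction and strict expansion of a linear map and its adjoint. -/

section LinearAlgebra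

variable {U W : Type*} [NormedAddCommGroup U] [InnerProductSpace ℝ U]
  [NormedAddCommGroup W] [InnerProductSpace ℝ W]

/-- A semidefinite symmetric form vanishes only on its kernel. -/
theorem eq_zero_of_inner_self_eq_zero {T : W →ₗ[ℝ] W} (hT : T.IsSymmetric)
    (h : ∀ u, 0 ≤ inner ℝ u (T u)) {u : W} (hu : inner ℝ u (T u) = 0) : T u = 0 := by
  have key : ∀ t : ℝ, 0 ≤ 2 * t * ‖T u‖ ^ 2 + t ^ 2 * inner ℝ (T u) (T (T u)) := by
    intro t
    have := h (u + t • T u)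
    have e : inner ℝ u (T (T u)) = ‖T u‖ ^ 2 := by
      rw [← hT, real_inner_self_eq_norm_sq]
    simp only [map_add, map_smul, inner_add_left, inner_add_right, real_inner_smul_left,
      real_inner_smul_right, hu, e, real_inner_self_eq_norm_sq] at this
    linarith
  by_contra hne
  have hp : 0 < ‖T u‖ ^ 2 := by positivity
  have h0 := h (T u)
  set a := ‖T u‖ ^ 2
  set c := inner ℝ (T u) (T (T u))
  have hc : 0 < c + 1 := by linarith
  -- Near-minimiser of the quadratic in `t`; `c + 1` replaces `c`, which may be zero.
  have := key (-a / (c + 1))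
  have e : 2 * (-a / (c + 1)) * a + (-a / (c + 1)) ^ 2 * c
      = -(a ^ 2 * (c + 2) / (c + 1) ^ 2) := by
    field_simp
    ring
  have : 0 < a ^ 2 * (c + 2) / (c + 1) ^ 2 := by positivity
  linarith

variable [FiniteDimensional ℝ U] [FiniteDimensional ℝ W]

theorem norm_adjoint_sq_sub (H : U →ₗ[ℝ] W) (u : W) :
    inner ℝ u (H (H.adjoint u) - u) = ‖H.adjoint u‖ ^ 2 - ‖u‖ ^ 2 := by
  rw [inner_sub_right, ← LinearMap.adjoint_inner_left, real_inner_self_eq_norm_sq,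
    real_inner_self_eq_norm_sq]

theorem isSymmetric_comp_adjoint_sub_id (H : U →ₗ[ℝ] W) :
    (H ∘ₗ H.adjoint - LinearMap.id).IsSymmetric := by
  intro a b
  simp [inner_sub_left, inner_sub_right, ← LinearMap.adjoint_inner_right]

/-- A vector where the semidefinite form vanishes lies in the kernel of `1 - H Hᵀ`, which `hk` makes
trivial. This is how nonsingularity of the Hessian enters. -/
theorem norm_adjoint_lt_of_le {H : U →ₗ[ℝ] W} (hk : ∀ u, H (H.adjoint u) = u → u = 0)
    (h : ∀ u, ‖H.adjoint u‖ ^ 2 - ‖u‖ ^ 2 ≤ 0) {u : W} (hu : u ≠ 0) :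
    ‖H.adjoint u‖ ^ 2 - ‖u‖ ^ 2 < 0 := by
  refine lt_of_le_of_ne (h u) fun e => hu (hk u ?_)
  have hT : (LinearMap.id - H ∘ₗ H.adjoint).IsSymmetric := fun a b => by
    have := isSymmetric_comp_adjoint_sub_id H a b
    rw [← neg_sub]
    simpa only [LinearMap.neg_apply, inner_neg_left, inner_neg_right, neg_inj] using this
  have hi : ∀ w, inner ℝ w ((LinearMap.id - H ∘ₗ H.adjoint : W →ₗ[ℝ] W) w)
      = -(‖H.adjoint w‖ ^ 2 - ‖w‖ ^ 2) := fun w => by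
    rw [← norm_adjoint_sq_sub, ← inner_neg_right, neg_sub]
    rfl
  have := eq_zero_of_inner_self_eq_zero hT (u := u) (fun w => by rw [hi]; linarith [h w])
    (by rw [hi, e, neg_zero])
  exact (sub_eq_zero.1 this).symm

theorem lt_norm_adjoint_of_le {H : U →ₗ[ℝ] W} (hk : ∀ u, H (H.adjoint u) = u → u = 0)
    (h : ∀ u, 0 ≤ ‖H.adjoint u‖ ^ 2 - ‖u‖ ^ 2) {u : W} (hu : u ≠ 0) :
    0 < ‖H.adjoint u‖ ^ 2 - ‖u‖ ^ 2 := by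
  refine lt_of_le_of_ne (h u) fun e => hu (hk u ?_)
  have := eq_zero_of_inner_self_eq_zero (isSymmetric_comp_adjoint_sub_id H) (u := u)
    (fun w => by simpa [norm_adjoint_sq_sub] using h w)
    (by simpa [norm_adjoint_sq_sub] using e.symm)
  simpa [sub_eq_zero] using this

/-- `H` sends fixed vectors of `Hᵀ H` to fixed vectors of `H Hᵀ`. -/
theorem adjoint_comp_fixed_trivial {H : U →ₗ[ℝ] W} (hk : ∀ u, H (H.adjoint u) = u → u = 0) :
    ∀ v, H.adjoint (H v) = v → v = 0 := by
  intro v hv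
  have := hk (H v) (by rw [hv])
  rw [← hv, this, map_zero]

/-- Cauchy–Schwarz: `‖Hv‖² = ⟨v, Hᵀ H v⟩ ≤ ‖v‖ ‖Hᵀ(Hv)‖`, and the last factor is below `‖Hv‖`. -/
theorem norm_lt_of_norm_adjoint_lt {H : U →ₗ[ℝ] W}
    (h : ∀ u, u ≠ 0 → ‖H.adjoint u‖ < ‖u‖) {v : U} (hv : v ≠ 0) : ‖H v‖ < ‖v‖ := by
  by_cases h0 : H v = 0
  · simpa [h0] using hv
  have h1 := h _ h0
  have h2 : ‖H v‖ ^ 2 ≤ ‖v‖ * ‖H.adjoint (H v)‖ := by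
    rw [← real_inner_self_eq_norm_sq, ← LinearMap.adjoint_inner_right]
    exact real_inner_le_norm _ _
  have h3 : 0 < ‖H v‖ := norm_pos_iff.2 h0
  have h4 : 0 < ‖v‖ := norm_pos_iff.2 hv
  nlinarith

/-- Expansion makes `Hᵀ` injective, hence onto by equality of dimensions, so `v = Hᵀu` and
Cauchy–Schwarz applies to `‖Hᵀu‖² = ⟨H Hᵀu, u⟩`. If `U` had the larger dimension, `H` would have a
kernel. -/
theorem lt_norm_of_lt_norm_adjoint {H : U →ₗ[ℝ] W}
    (hd : Module.finrank ℝ U = Module.finrank ℝ W)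
    (h : ∀ u, u ≠ 0 → ‖u‖ < ‖H.adjoint u‖) {v : U} (hv : v ≠ 0) : ‖v‖ < ‖H v‖ := by
  have hinj : Function.Injective H.adjoint := by
    rw [injective_iff_map_eq_zero]
    intro u hu
    by_contra h0
    have := h u h0
    rw [hu, norm_zero] at this
    exact absurd (norm_nonneg u) (not_le.2 this)
  obtain ⟨u, rfl⟩ := (LinearMap.injective_iff_surjective_of_finrank_eq_finrank hd.symm).1 hinj v
  have hu : u ≠ 0 := by
    rintro rfl
    simp at hv
  have h1 := h u hu
  have h2 : ‖H.adjoint u‖ ^ 2 ≤ ‖H (H.adjoint u)‖ * ‖u‖ := by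
    rw [← real_inner_self_eq_norm_sq, LinearMap.adjoint_inner_right]
    exact real_inner_le_norm _ _
  have h3 : 0 < ‖u‖ := norm_pos_iff.2 hu
  nlinarith

end LinearAlgebra

/-! ### Second-order conditions from a Peano expansion. -/

section SecondOrder

variable {E : Type*} [NormedAddCommGroup E] [NormedSpace ℝ E]

open Asymptotics Filter

/-- Second-order Taylor expansion with Peano remainder. -/
theorem taylor_two_isLittleO {g : E → ℝ} {g' : E → E →L[ℝ] ℝ} {B : E →L[ℝ] E →L[ℝ] ℝ} {x : E}
    (hg : ∀ᶠ z in 𝓝 x, HasFDerivAt g (g' z) z) (hB : HasFDerivAt g' B x) :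
    (fun k => g (x + k) - g x - g' x k - 1 / 2 * B k k) =o[𝓝 0] fun k => ‖k‖ ^ 2 := by
  have hsymm : ∀ v w, B v w = B w v := fun v w =>
    second_derivative_symmetric_of_eventually hg hB v w
  rw [isLittleO_iff]
  intro ε hε
  have h1 := (hasFDerivAt_iff_isLittleO_nhds_zero.1 hB).def hε
  have h2 : ∀ᶠ k in 𝓝 (0 : E), HasFDerivAt g (g' (x + k)) (x + k) := by
    have : Tendsto (fun k : E => x + k) (𝓝 0) (𝓝 x) := by
      simpa using (continuous_const_add x).tendsto (0 : E)
    exact this.eventually hg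
  obtain ⟨δ, hδ, hball⟩ := Metric.eventually_nhds_iff_ball.1 (h1.and h2)
  filter_upwards [Metric.ball_mem_nhds (0 : E) hδ] with k hk
  set r : E → ℝ := fun k => g (x + k) - g x - g' x k - 1 / 2 * B k k with hr
  -- By symmetry of `B`, the remainder has derivative `g'(x+z) - g'(x) - Bz`. This is at most `ε‖k‖`
  -- on the ball of radius `‖k‖`, and the mean value inequality concludes.
  have hder : ∀ z ∈ Metric.closedBall (0 : E) ‖k‖,
      HasFDerivWithinAt r (g' (x + z) - g' x - B z) (Metric.closedBall (0 : E) ‖k‖) z := by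
    intro z hz
    have hz' : z ∈ Metric.ball (0 : E) δ := by
      simp only [Metric.mem_closedBall, dist_zero_right, Metric.mem_ball] at *
      linarith
    have e1 : HasFDerivAt (fun k => g (x + k)) (g' (x + z)) z := by
      exact (hball z hz').2.comp z ((hasFDerivAt_id z).const_add x)
    have e2 : HasFDerivAt (fun k => B k k) (B z + B.flip z) z := by
      have := B.hasFDerivAt (x := z) |>.clm_apply (hasFDerivAt_id z)
      simpa using this
    have e3 := (((e1.sub_const (g x)).sub (g' x).hasFDerivAt).sub
      (e2.const_mul (1 / 2))).hasFDerivWithinAt (s := Metric.closedBall (0 : E) ‖k‖)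
    refine e3.congr_fderiv ?_
    ext w
    simp [hsymm w z]
    ring
  have hbound : ∀ z ∈ Metric.closedBall (0 : E) ‖k‖, ‖g' (x + z) - g' x - B z‖ ≤ ε * ‖k‖ := by
    intro z hz
    have hz' : z ∈ Metric.ball (0 : E) δ := by
      simp only [Metric.mem_closedBall, dist_zero_right, Metric.mem_ball] at *
      linarith
    refine (hball z hz').1.trans ?_
    simp only [Metric.mem_closedBall, dist_zero_right] at hz
    gcongr
  have := (convex_closedBall (0 : E) ‖k‖).norm_image_sub_le_of_norm_hasFDerivWithin_le hder hbound
    (x := 0) (y := k) (by simp) (by simp)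
  have r0 : r 0 = 0 := by simp [hr]
  rw [r0, sub_zero, sub_zero] at this
  rw [norm_pow, norm_norm]
  calc ‖r k‖ ≤ ε * ‖k‖ * ‖k‖ := this
    _ = ε * ‖k‖ ^ 2 := by ring

variable {g : E → ℝ} {P : E → ℝ} {x : E}

theorem nonpos_of_isLocalMax_of_isLittleO (hP : ∀ (t : ℝ) h, P (t • h) = t ^ 2 * P h)
    (ho : (fun h => g (x + h) - g x - 1 / 2 * P h) =o[𝓝 0] fun h => ‖h‖ ^ 2)
    (hmax : IsLocalMax g x) (h : E) : P h ≤ 0 := by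
  by_contra! hpos
  have hh : Tendsto (fun t : ℝ => t • h) (𝓝[>] 0) (𝓝 0) := by
    have : Tendsto (fun t : ℝ => t • h) (𝓝 0) (𝓝 ((0 : ℝ) • h)) :=
      (continuous_id.smul continuous_const).tendsto _
    rw [zero_smul] at this
    exact this.mono_left nhdsWithin_le_nhds
  have hx : Tendsto (fun k : E => x + k) (𝓝 0) (𝓝 x) := by
    simpa using (continuous_const_add x).tendsto (0 : E)
  -- Along `t • h` this keeps the error below `t² P h / 4`, less than the main term `t² P h / 2`.
  have hε : 0 < P h / (4 * (‖h‖ ^ 2 + 1)) := by positivity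
  have h1 := hh.eventually ((ho.def hε).and (hx.eventually hmax))
  obtain ⟨t, ⟨h2, h3⟩, h4⟩ := (h1.and self_mem_nhdsWithin).exists
  have ht : 0 < t := h4
  rw [hP, norm_pow, norm_norm, norm_smul, Real.norm_of_nonneg ht.le, mul_pow] at h2
  have h5 := (neg_le_abs _).trans h2
  have h6 : P h / (4 * (‖h‖ ^ 2 + 1)) * (t ^ 2 * ‖h‖ ^ 2) ≤ t ^ 2 * P h / 4 := by
    rw [div_mul_eq_mul_div, div_le_div_iff₀ (by positivity) (by positivity)]
    have : 0 < t ^ 2 * P h := by positivity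
    nlinarith
  have : 0 < t ^ 2 * P h := by positivity
  linarith

theorem isLocalMax_of_isLittleO_of_neg [FiniteDimensional ℝ E]
    (hP : ∀ (t : ℝ) h, P (t • h) = t ^ 2 * P h) (hc : Continuous P)
    (ho : (fun h => g (x + h) - g x - 1 / 2 * P h) =o[𝓝 0] fun h => ‖h‖ ^ 2)
    (hneg : ∀ h, h ≠ 0 → P h < 0) : IsLocalMax g x := by
  -- Compactness of the unit sphere and homogeneity; the sphere is empty when the space is trivial.
  obtain ⟨c, hc0, hcP⟩ : ∃ c > 0, ∀ h, P h ≤ -c * ‖h‖ ^ 2 := by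
    rcases (Metric.sphere (0 : E) 1).eq_empty_or_nonempty with he | hne
    · refine ⟨1, one_pos, fun h => ?_⟩
      have h0 : h = 0 := by
        by_contra h0
        have : ‖h‖⁻¹ • h ∈ Metric.sphere (0 : E) 1 := by
          simp [norm_smul, inv_mul_cancel₀ (norm_ne_zero_iff.2 h0)]
        simp [he] at this
      have h1 : P 0 = 0 := by simpa using hP 0 0
      simp [h0, h1]
    · obtain ⟨z, hz, hzm⟩ := (isCompact_sphere (0 : E) 1).exists_isMaxOn hne hc.continuousOn
      have hz0 : z ≠ 0 := by
        rintro rfl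
        simp at hz
      refine ⟨-P z, by linarith [hneg z hz0], fun h => ?_⟩
      rw [neg_neg]
      by_cases h0 : h = 0
      · have h1 : P 0 = 0 := by simpa using hP 0 0
        simp [h0, h1]
      have hn : ‖h‖ ≠ 0 := norm_ne_zero_iff.2 h0
      have hm : ‖h‖⁻¹ • h ∈ Metric.sphere (0 : E) 1 := by
        simp [norm_smul, inv_mul_cancel₀ hn]
      have h1 : P (‖h‖⁻¹ • h) ≤ P z := hzm hm
      have h2 : P h = ‖h‖ ^ 2 * P (‖h‖⁻¹ • h) := by
        rw [← hP, smul_smul, mul_inv_cancel₀ hn, one_smul]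
      rw [h2, mul_comm]
      gcongr
  have hx : Tendsto (fun z : E => z - x) (𝓝 x) (𝓝 0) := by
    simpa using (continuous_sub_right x).tendsto x
  filter_upwards [hx.eventually (ho.def (half_pos hc0))] with z hz
  rw [norm_pow, norm_norm, add_sub_cancel] at hz
  have := (le_abs_self _).trans hz
  linarith [hcP (z - x)]

theorem nonneg_of_isLocalMin_of_isLittleO (hP : ∀ (t : ℝ) h, P (t • h) = t ^ 2 * P h)
    (ho : (fun h => g (x + h) - g x - 1 / 2 * P h) =o[𝓝 0] fun h => ‖h‖ ^ 2)
    (hmin : IsLocalMin g x) (h : E) : 0 ≤ P h := by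
  have := nonpos_of_isLocalMax_of_isLittleO (g := fun z => -g z) (P := fun z => -P z)
    (fun t h => by rw [hP, mul_neg]) (ho.neg_left.congr_left fun h => by ring) hmin.neg h
  linarith

theorem isLocalMin_of_isLittleO_of_pos [FiniteDimensional ℝ E]
    (hP : ∀ (t : ℝ) h, P (t • h) = t ^ 2 * P h) (hc : Continuous P)
    (ho : (fun h => g (x + h) - g x - 1 / 2 * P h) =o[𝓝 0] fun h => ‖h‖ ^ 2)
    (hpos : ∀ h, h ≠ 0 → 0 < P h) : IsLocalMin g x := by
  have := (isLocalMax_of_isLittleO_of_neg (g := fun z => -g z) (P := fun z => -P z)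
    (fun t h => by rw [hP, mul_neg]) hc.neg (ho.neg_left.congr_left fun h => by ring)
    fun h h0 => neg_lt_zero.2 (hpos h h0)).neg
  simpa using this

end SecondOrder

end CanonicalDuality

namespace CanonicalDuality

/-! ### Gradient and second-order expansion of the Fenchel conjugate. -/

section Conjugate

open Asymptotics Filter

theorem coe_toReal_of_mem_edom {E : Type*} {V : E → EReal} (hb : ∀ y, V y ≠ ⊥) {y : E}
    (hy : y ∈ edom V) :
    ((V y).toReal : EReal) = V y :=
  EReal.coe_toReal (ne_of_lt hy) (hb y)

variable {E : Type*} [NormedAddCommGroup E] [InnerProductSpace ℝ E]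

theorem deriv_le_of_eventually_le {φ : ℝ → ℝ} {d M : ℝ} (hd : HasDerivAt φ d 0)
    (h : ∀ᶠ t in 𝓝[>] (0 : ℝ), φ t ≤ φ 0 + t * M) : d ≤ M := by
  refine le_of_tendsto hd.tendsto_slope_zero_right ?_
  filter_upwards [h, self_mem_nhdsWithin] with t ht ht0
  have ht0 : 0 < t := ht0
  rw [zero_add, smul_eq_mul, inv_mul_le_iff₀ ht0]
  linarith

theorem eventually_Ioo_zero_one : ∀ᶠ t in 𝓝[>] (0 : ℝ), 0 < t ∧ t < 1 :=
  Ioo_mem_nhdsGT one_pos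

theorem hasDerivAt_comp_segment {g : E → ℝ} {g' : E →L[ℝ] ℝ} {y : E} (hg : HasFDerivAt g g' y)
    (v : E) : HasDerivAt (fun t : ℝ => g (y + t • v)) (g' v) 0 := by
  have h1 : HasDerivAt (fun t : ℝ => y + t • v) v 0 := by
    simpa using ((hasDerivAt_id (0 : ℝ)).smul_const v).const_add y
  have h2 : HasFDerivAt g g' (y + (0 : ℝ) • v) := by simpa using hg
  exact h2.comp_hasDerivAt (0 : ℝ) h1

/-- The gradient inequality for convex functions. -/
theorem gradient_inequality {C : Set E} {g : E → ℝ} {g' : E →L[ℝ] ℝ} {y z : E}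
    (hg : ConvexOn ℝ C g) (hy : y ∈ C) (hd : HasFDerivAt g g' y) (hz : z ∈ C) :
    g y + g' (z - y) ≤ g z := by
  have := deriv_le_of_eventually_le (M := g z - g y) (hasDerivAt_comp_segment hd (z - y)) (by
    filter_upwards [eventually_Ioo_zero_one] with t ht
    have h1 := hg.2 hy hz (sub_nonneg.2 ht.2.le) ht.1.le (by ring : 1 - t + t = 1)
    have e : (1 - t) • y + t • z = y + t • (z - y) := by module
    rw [e, smul_eq_mul, smul_eq_mul] at h1
    simp only [zero_smul, add_zero]
    linarith)
  linarith

variable {V : E → EReal}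

theorem coe_le_conj (hb : ∀ y, V y ≠ ⊥) {y : E} (hy : y ∈ edom V) (σ : E) :
    ((inner ℝ y σ - (V y).toReal : ℝ) : EReal) ≤ conj V σ := by
  rw [EReal.coe_sub, coe_toReal_of_mem_edom hb hy]
  exact le_iSup (fun y : E => ((inner ℝ y σ : ℝ) : EReal) - V y) y

theorem conj_le_coe (hb : ∀ y, V y ≠ ⊥) {σ : E} {c : ℝ}
    (h : ∀ y ∈ edom V, inner ℝ y σ - (V y).toReal ≤ c) : conj V σ ≤ c := by
  refine iSup_le fun y => ?_
  by_cases hy : y ∈ edom V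
  · rw [← coe_toReal_of_mem_edom hb hy, ← EReal.coe_sub]
    exact_mod_cast h y hy
  · have : V y = ⊤ := by simpa [edom] using hy
    simp [this]

theorem isLUB_conj (hb : ∀ y, V y ≠ ⊥) {σ : E} (h1 : conj V σ ≠ ⊤) (h2 : conj V σ ≠ ⊥) :
    IsLUB ((fun y => inner ℝ y σ - (V y).toReal) '' edom V) (conj V σ).toReal := by
  constructor
  · rintro _ ⟨y, hy, rfl⟩
    have := coe_le_conj hb hy σ
    rw [← EReal.coe_toReal h1 h2] at this
    exact_mod_cast this
  · intro c hc
    have := conj_le_coe hb (σ := σ) (c := c) fun y hy => hc ⟨y, hy, rfl⟩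
    rw [← EReal.coe_toReal h1 h2] at this
    exact_mod_cast this

/-- If `V*` has gradient `y` at `σ` and `V` has gradient `τ` at `y`, then `τ = σ`. -/
theorem gradient_conj_gradient (hV : IsGamma V) {y σ τ : E} (hy' : edom V ∈ 𝓝 y)
    (hd : HasFDerivAt (fun w => (V w).toReal) (innerSL ℝ τ) y)
    (hfin : ∀ᶠ w in 𝓝 σ, conj V w ≠ ⊤ ∧ conj V w ≠ ⊥)
    (hc : HasFDerivAt (fun w => (conj V w).toReal) (innerSL ℝ y) σ) :
    τ = σ ∧ (conj V σ).toReal = inner ℝ y σ - (V y).toReal := by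
  have hy : y ∈ edom V := mem_of_mem_nhds hy'
  have hσ := isLUB_conj hV.ne_bot hfin.self_of_nhds.1 hfin.self_of_nhds.2
  -- The supremum defining `V*(τ)` is attained at `y`.
  have hτ : ∀ z ∈ edom V, inner ℝ z τ - (V z).toReal ≤ inner ℝ y τ - (V y).toReal := by
    intro z hz
    have := gradient_inequality hV.convex hy hd hz
    rw [innerSL_apply_apply, inner_sub_right, real_inner_comm, real_inner_comm y] at this
    linarith
  -- `V*` lies below its chord from `σ` to `τ`, so its slope at `σ` is at most the chord's. The
  -- outcome is the reverse of the Fenchel–Young inequality at `(y, σ)`.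
  have hle : inner ℝ y (τ - σ) ≤ inner ℝ y τ - (V y).toReal - (conj V σ).toReal := by
    refine deriv_le_of_eventually_le (hasDerivAt_comp_segment hc (τ - σ)) ?_
    have ht : Tendsto (fun t : ℝ => σ + t • (τ - σ)) (𝓝[>] 0) (𝓝 σ) := by
      have : Tendsto (fun t : ℝ => σ + t • (τ - σ)) (𝓝 0) (𝓝 (σ + (0 : ℝ) • (τ - σ))) :=
        Continuous.tendsto (by fun_prop) _
      rw [zero_smul, add_zero] at this
      exact this.mono_left nhdsWithin_le_nhds
    filter_upwards [eventually_Ioo_zero_one, ht.eventually hfin] with t ht hf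
    refine (isLUB_conj hV.ne_bot hf.1 hf.2).2 ?_
    rintro _ ⟨z, hz, rfl⟩
    have h1 := hτ z hz
    have h2 : inner ℝ z σ - (V z).toReal ≤ (conj V σ).toReal := hσ.1 ⟨z, hz, rfl⟩
    simp only [inner_add_right, inner_sub_right, real_inner_smul_right, zero_smul, add_zero]
    nlinarith [mul_le_mul_of_nonneg_left h1 ht.1.le,
      mul_le_mul_of_nonneg_left h2 (sub_nonneg.2 ht.2.le)]
  have hge : inner ℝ y σ - (V y).toReal ≤ (conj V σ).toReal := hσ.1 ⟨y, hy, rfl⟩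
  rw [inner_sub_right] at hle
  have heq : (conj V σ).toReal = inner ℝ y σ - (V y).toReal := by linarith
  refine ⟨?_, heq⟩
  -- Equality in Fenchel–Young makes `y` a minimiser of `V - ⟨σ, ·⟩`.
  have hmin : IsLocalMin (fun z => (V z).toReal - innerSL ℝ σ z) y := by
    filter_upwards [hy'] with z hz
    have h2 : inner ℝ z σ - (V z).toReal ≤ (conj V σ).toReal := hσ.1 ⟨z, hz, rfl⟩
    rw [innerSL_apply_apply, innerSL_apply_apply, real_inner_comm, real_inner_comm z]
    linarith
  have h0 := hmin.hasFDerivAt_eq_zero (hd.sub (innerSL ℝ σ).hasFDerivAt)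
  rw [← map_sub] at h0
  rw [← sub_eq_zero, ← inner_self_eq_zero (𝕜 := ℝ), ← innerSL_apply_apply ℝ, h0]
  rfl

/-- Second-order expansion of the conjugate of a convex function. -/
theorem conj_isLittleO {C : Set E} {g s : E → ℝ} {y σ : E} {F G R : E →L[ℝ] E}
    (hg : ConvexOn ℝ C g) (hy : C ∈ 𝓝 y)
    (hFG : ∀ k h, inner ℝ k h = inner ℝ (F k) (G h))
    (hFR : ∀ w, F (R w) = w) (hRF : ∀ k, R (F k) = k)
    (hexp : (fun k => g (y + k) - g y - inner ℝ σ k - 1 / 2 * ‖F k‖ ^ 2)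
      =o[𝓝 0] fun k => ‖k‖ ^ 2)
    (hs : ∀ᶠ w in 𝓝 σ, IsLUB ((fun z => inner ℝ z w - g z) '' C) (s w))
    (hsσ : s σ = inner ℝ y σ - g y) :
    (fun h => s (σ + h) - s σ - inner ℝ y h - 1 / 2 * ‖G h‖ ^ 2) =o[𝓝 0] fun h => ‖h‖ ^ 2 := by
  rw [isLittleO_iff]
  intro ε hε
  obtain ⟨M, hM, hRM⟩ : ∃ M > 0, ∀ k, ‖k‖ ≤ M * ‖F k‖ := by
    refine ⟨‖R‖ + 1, by positivity, fun k => ?_⟩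
    have := R.le_opNorm (F k)
    rw [hRF] at this
    nlinarith [norm_nonneg (F k)]
  obtain ⟨N, hN, hGN⟩ : ∃ N > 0, ∀ h, ‖G h‖ ≤ N * ‖h‖ := by
    refine ⟨‖G‖ + 1, by positivity, fun h => ?_⟩
    nlinarith [norm_nonneg h, G.le_opNorm h]
  -- `θ` is the relative error allowed on both forms; `θ ≤ 1/2` gives `1/(1-θ) ≤ 1 + 2θ`, used in
  -- the near case below.
  obtain ⟨θ, hθ, hθ1, hθε⟩ : ∃ θ > 0, θ ≤ 1 / 2 ∧ θ * N ^ 2 ≤ ε := by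
    refine ⟨min (1 / 2) (ε / N ^ 2), by positivity, min_le_left _ _, ?_⟩
    rw [← le_div_iff₀ (by positivity)]
    exact min_le_right _ _
  have hη : 0 < θ / (2 * M ^ 2) := by positivity
  have hyt : Tendsto (fun k : E => y + k) (𝓝 0) (𝓝 y) := by
    simpa using (continuous_const_add y).tendsto (0 : E)
  have hσt : Tendsto (fun k : E => σ + k) (𝓝 0) (𝓝 σ) := by
    simpa using (continuous_const_add σ).tendsto (0 : E)
  obtain ⟨δ, hδ, hball⟩ := Metric.eventually_nhds_iff_ball.1 ((hexp.def hη).and (hyt.eventually hy))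
  have hloc : ∀ k, ‖k‖ < δ → y + k ∈ C ∧
      |g (y + k) - g y - inner ℝ σ k - 1 / 2 * ‖F k‖ ^ 2| ≤ θ / 2 * ‖F k‖ ^ 2 := by
    intro k hk
    obtain ⟨h1, h2⟩ := hball k (by simpa using hk)
    refine ⟨h2, h1.trans ?_⟩
    rw [norm_pow, norm_norm]
    calc θ / (2 * M ^ 2) * ‖k‖ ^ 2 ≤ θ / (2 * M ^ 2) * (M * ‖F k‖) ^ 2 := by
          gcongr
          exact hRM k
      _ = θ / 2 * ‖F k‖ ^ 2 := by
          field_simp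
  -- The first radius serves the far case of the upper bound; the second keeps the test point `R (G
  -- h)` within `δ`.
  have hsmall : ∀ᶠ h in 𝓝 (0 : E), ‖h‖ < min (δ / (16 * M ^ 2)) (δ / (M * N)) := by
    have : 0 < min (δ / (16 * M ^ 2)) (δ / (M * N)) := by positivity
    filter_upwards [Metric.ball_mem_nhds (0 : E) this] with h hh
    exact mem_ball_zero_iff.1 hh
  filter_upwards [hsmall, hσt.eventually hs] with h hh hlub
  have hh1 := hh.trans_le (min_le_left _ _)
  have hh2 := hh.trans_le (min_le_right _ _)
  have hGh : θ * ‖G h‖ ^ 2 ≤ ε * ‖h‖ ^ 2 := by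
    calc θ * ‖G h‖ ^ 2 ≤ θ * (N * ‖h‖) ^ 2 := by
          gcongr
          exact hGN h
      _ = θ * N ^ 2 * ‖h‖ ^ 2 := by ring
      _ ≤ ε * ‖h‖ ^ 2 := by gcongr
  rw [norm_pow, norm_norm, Real.norm_eq_abs, abs_le]
  constructor
  -- Lower bound: test the supremum at the maximiser `k = R (G h)` of the model `⟨k, h⟩ - ½‖F k‖²`.
  · have hF : F (R (G h)) = G h := hFR _
    have hk : ‖R (G h)‖ < δ := by
      have h1 := hRM (R (G h))
      rw [hF] at h1
      have h2 := hGN h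
      rw [lt_div_iff₀ (by positivity)] at hh2
      nlinarith [mul_le_mul_of_nonneg_left h2 hM.le]
    obtain ⟨h1, h2⟩ := hloc _ hk
    have h3 : inner ℝ (y + R (G h)) (σ + h) - g (y + R (G h)) ≤ s (σ + h) := hlub.1 ⟨_, h1, rfl⟩
    have h4 := (le_abs_self _).trans h2
    rw [hF] at h4
    have h5 : inner ℝ (R (G h)) h = ‖G h‖ ^ 2 := by
      rw [hFG, hF, real_inner_self_eq_norm_sq]
    simp only [inner_add_left, inner_add_right, h5] at h3
    rw [real_inner_comm] at h4
    nlinarith [norm_nonneg (G h)]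
  · suffices hup : s (σ + h) ≤ s σ + inner ℝ y h + 1 / 2 * ‖G h‖ ^ 2 + θ * ‖G h‖ ^ 2 by linarith
    refine hlub.2 ?_
    rintro _ ⟨z, hz, rfl⟩
    obtain ⟨k, rfl⟩ : ∃ k, z = y + k := ⟨z - y, by abel⟩
    suffices hk : inner ℝ k h - (g (y + k) - g y - inner ℝ σ k)
        ≤ 1 / 2 * ‖G h‖ ^ 2 + θ * ‖G h‖ ^ 2 by
      simp only [inner_add_left, inner_add_right]
      rw [real_inner_comm k σ] at hk
      linarith
    rcases lt_or_ge ‖k‖ δ with hkδ | hkδ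
    · have h1 := (abs_le.1 (hloc k hkδ).2).1
      have h2 : inner ℝ k h ≤ ‖F k‖ * ‖G h‖ := by
        rw [hFG]
        exact real_inner_le_norm _ _
      have h3 : ‖F k‖ * ‖G h‖ - (1 - θ) / 2 * ‖F k‖ ^ 2 ≤ (1 / 2 + θ) * ‖G h‖ ^ 2 := by
        set a := ‖F k‖
        set b := ‖G h‖
        nlinarith [sq_nonneg ((1 - θ) * a - b), sq_nonneg a, sq_nonneg b,
          mul_nonneg hθ.le (sq_nonneg b),
          mul_nonneg (mul_nonneg hθ.le (sub_nonneg.2 hθ1)) (sq_nonneg b)]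
      linarith
    -- Far points: shrink `k` to length `δ/2`. There `g` exceeds its tangent by at least `¼‖F (t •
    -- k)‖²`, which outweighs the linear term in `h`; convexity carries this out to `k`.
    · have hk0 : 0 < ‖k‖ := hδ.trans_le hkδ
      set t := δ / (2 * ‖k‖) with ht
      have ht0 : 0 < t := by positivity
      have ht1 : t ≤ 1 / 2 := by
        rw [ht, div_le_div_iff₀ (by positivity) (by positivity)]
        linarith
      have htk : ‖t • k‖ = δ / 2 := by
        rw [norm_smul, Real.norm_of_nonneg ht0.le, ht]
        field_simp
      have h1 := (abs_le.1 (hloc (t • k) (by rw [htk]; linarith)).2).1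
      have h2 := hg.2 (mem_of_mem_nhds hy) hz (by linarith : 0 ≤ 1 - t) ht0.le (by ring)
      have e : (1 - t) • y + t • (y + k) = y + t • k := by module
      rw [e, smul_eq_mul, smul_eq_mul] at h2
      rw [real_inner_smul_right] at h1
      have h3 := hRM (t • k)
      rw [htk] at h3
      have h4 : δ ^ 2 / (16 * M ^ 2) ≤ 1 / 4 * ‖F (t • k)‖ ^ 2 := by
        rw [div_le_iff₀ (by positivity)]
        nlinarith [mul_self_le_mul_self (by positivity) h3]
      have h5 : t * inner ℝ k h ≤ δ ^ 2 / (16 * M ^ 2) := by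
        have h6 : inner ℝ k h ≤ ‖k‖ * ‖h‖ := real_inner_le_norm _ _
        calc t * inner ℝ k h ≤ t * (‖k‖ * ‖h‖) := by gcongr
          _ = δ / 2 * ‖h‖ := by rw [ht]; field_simp
          _ ≤ δ / 2 * (δ / (16 * M ^ 2)) := by gcongr
          _ ≤ δ * (δ / (16 * M ^ 2)) := by gcongr; linarith
          _ = δ ^ 2 / (16 * M ^ 2) := by ring
      have h7 : t * (inner ℝ k h - (g (y + k) - g y - inner ℝ σ k)) ≤ 0 := by
        nlinarith [sq_nonneg ‖F (t • k)‖]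
      have h8 : inner ℝ k h - (g (y + k) - g y - inner ℝ σ k) ≤ 0 :=
        nonpos_of_mul_nonpos_right h7 ht0
      have : 0 ≤ 1 / 2 * ‖G h‖ ^ 2 + θ * ‖G h‖ ^ 2 := by positivity
      linarith

end Conjugate

end CanonicalDuality

noncomputable section

namespace CanonicalDuality

/-! ### Matrices as operators and bilinear forms on Euclidean space. -/

section Matrix

open Matrix

variable {k l p : ℕ}

theorem toEuclideanLin_mul_apply (A : Matrix (Fin k) (Fin l) ℝ) (B : Matrix (Fin l) (Fin p) ℝ)
    (x : EuclideanSpace ℝ (Fin p)) :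
    toEuclideanLin (A * B) x = toEuclideanLin A (toEuclideanLin B x) := by
  simp [toLpLin_apply, mulVec_mulVec]

theorem toEuclideanLin_one_apply (x : EuclideanSpace ℝ (Fin k)) :
    toEuclideanLin (1 : Matrix (Fin k) (Fin k) ℝ) x = x := by
  simp

theorem inner_toEuclideanLin_transpose (A : Matrix (Fin k) (Fin l) ℝ)
    (x : EuclideanSpace ℝ (Fin k)) (y : EuclideanSpace ℝ (Fin l)) :
    inner ℝ (toEuclideanLin Aᵀ x) y = inner ℝ x (toEuclideanLin A y) := by
  rw [← conjTranspose_eq_transpose_of_trivial, toEuclideanLin_conjTranspose_eq_adjoint,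
    LinearMap.adjoint_inner_left]

theorem inner_toEuclideanLin_of_isSymm {A : Matrix (Fin k) (Fin k) ℝ} (hA : A.IsSymm)
    (x y : EuclideanSpace ℝ (Fin k)) :
    inner ℝ (toEuclideanLin A x) y = inner ℝ x (toEuclideanLin A y) := by
  rw [← inner_toEuclideanLin_transpose, hA.eq]

/-- A bilinear form on `ℝᵏ` is represented by the matrix of its values on the standard basis. -/
theorem bilin_eq_inner_toEuclideanLin
    (B : EuclideanSpace ℝ (Fin k) →L[ℝ] EuclideanSpace ℝ (Fin k) →L[ℝ] ℝ)
    (u v : EuclideanSpace ℝ (Fin k)) :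
    B u v = inner ℝ u (toEuclideanLin (Matrix.of fun i j =>
      B (EuclideanSpace.single i 1) (EuclideanSpace.single j 1)) v) := by
  have hu : ∀ w : EuclideanSpace ℝ (Fin k), w = ∑ i, w i • EuclideanSpace.single i (1 : ℝ) := by
    intro w
    ext j
    simp [Pi.single_apply]
  conv_lhs => rw [hu u, hu v]
  simp only [map_sum, map_smul, _root_.sum_apply, _root_.smul_apply,
    PiLp.inner_apply, toLpLin_apply, mulVec, dotProduct, of_apply, smul_eq_mul,
    RCLike.inner_apply, conj_trivial, Finset.sum_mul, Finset.mul_sum]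
  rw [Finset.sum_comm]
  refine Finset.sum_congr rfl fun i _ => Finset.sum_congr rfl fun j _ => by ring

theorem hasFDerivAt_quadratic {A : Matrix (Fin k) (Fin k) ℝ} (hA : A.IsSymm)
    (b : EuclideanSpace ℝ (Fin k)) (c : ℝ) (z : EuclideanSpace ℝ (Fin k)) :
    HasFDerivAt (fun x => 1 / 2 * inner ℝ x (toEuclideanLin A x) - inner ℝ b x + c)
      (innerSL ℝ (toEuclideanLin A z - b)) z := by
  have h1 := (((hasFDerivAt_id z).inner ℝ
    (toEuclideanLin A).toContinuousLinearMap.hasFDerivAt).const_mul (1 / 2)).sub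
    (innerSL ℝ b).hasFDerivAt |>.add_const c
  refine h1.congr_fderiv ?_
  ext w
  have e1 : inner ℝ w (toEuclideanLin A z) = inner ℝ (toEuclideanLin A z) w := real_inner_comm _ _
  have e2 := inner_toEuclideanLin_of_isSymm hA z w
  simp [e1, ← e2]
  ring

end Matrix

/-! ### Derivatives of the quadratic family and of `q₀ + g ∘ q`. -/

namespace QuadFamily

open Matrix

variable {n m : ℕ} (Q : QuadFamily n m)

/-- The gradient `A_k x - b_k` of `q_k`. -/
def grad (k : Fin (m + 1)) (x : EuclideanSpace ℝ (Fin n)) : EuclideanSpace ℝ (Fin n) :=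
  toEuclideanLin (Q.A k) x - Q.b k

theorem hasFDerivAt_quad (k : Fin (m + 1)) (z : EuclideanSpace ℝ (Fin n)) :
    HasFDerivAt (Q.quad k) (innerSL ℝ (Q.grad k z)) z :=
  hasFDerivAt_quadratic (Q.symm k) (Q.b k) (Q.c k) z

theorem hasFDerivAt_grad (k : Fin (m + 1)) (z : EuclideanSpace ℝ (Fin n)) :
    HasFDerivAt (Q.grad k) (toEuclideanLin (Q.A k)).toContinuousLinearMap z :=
  (toEuclideanLin (Q.A k)).toContinuousLinearMap.hasFDerivAt.sub_const _

/-- The linear map `u ↦ (⟨w₁, u⟩, …, ⟨w_m, u⟩)`. -/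
def innerFamily (w : Fin m → EuclideanSpace ℝ (Fin n)) :
    EuclideanSpace ℝ (Fin n) →L[ℝ] EuclideanSpace ℝ (Fin m) :=
  LinearMap.toContinuousLinearMap
    { toFun := fun u => WithLp.toLp 2 fun i => inner ℝ (w i) u
      map_add' := fun u v => by ext; simp [inner_add_right]
      map_smul' := fun r v => by ext; simp [real_inner_smul_right] }

theorem innerFamily_apply (w : Fin m → EuclideanSpace ℝ (Fin n)) (u : EuclideanSpace ℝ (Fin n))
    (i : Fin m) : innerFamily w u i = inner ℝ (w i) u := rfl

/-- Identifies the transpose of `Dq` with `h ↦ ∑ h_i (A_i x - b_i)`, the map from which `J` is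
built. -/
theorem inner_innerFamily (w : Fin m → EuclideanSpace ℝ (Fin n)) (h : EuclideanSpace ℝ (Fin m))
    (u : EuclideanSpace ℝ (Fin n)) :
    inner ℝ h (innerFamily w u) = inner ℝ (∑ i, h i • w i) u := by
  rw [sum_inner, PiLp.inner_apply]
  simp only [real_inner_smul_left, innerFamily_apply, RCLike.inner_apply, conj_trivial, mul_comm]

/-- The derivative of `q`. -/
def dq (z : EuclideanSpace ℝ (Fin n)) :
    EuclideanSpace ℝ (Fin n) →L[ℝ] EuclideanSpace ℝ (Fin m) :=
  innerFamily fun i => Q.grad i.succ z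

theorem hasFDerivAt_q (z : EuclideanSpace ℝ (Fin n)) : HasFDerivAt Q.q (Q.dq z) z := by
  rw [← hasFDerivWithinAt_univ, hasFDerivWithinAt_euclidean]
  intro i
  exact (Q.hasFDerivAt_quad i.succ z).hasFDerivWithinAt

theorem hasFDerivAt_dq_apply (u z : EuclideanSpace ℝ (Fin n)) :
    HasFDerivAt (fun z => Q.dq z u)
      (innerFamily fun i : Fin m => toEuclideanLin (Q.A i.succ) u) z := by
  rw [← hasFDerivWithinAt_univ, hasFDerivWithinAt_euclidean]
  intro i
  have h := ((Q.hasFDerivAt_grad i.succ z).inner ℝ (hasFDerivAt_const u z)).hasFDerivWithinAt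
    (s := Set.univ)
  refine h.congr_fderiv ?_
  ext w
  have e := inner_toEuclideanLin_of_isSymm (Q.symm i.succ) w u
  simpa [innerFamily_apply, real_inner_comm _ w] using e

theorem contDiff_quad (k : Fin (m + 1)) : ContDiff ℝ 2 (Q.quad k) := by
  have : ContDiff ℝ 2 fun x => toEuclideanLin (Q.A k) x :=
    (toEuclideanLin (Q.A k)).toContinuousLinearMap.contDiff
  exact ((contDiff_const.mul (contDiff_id.inner ℝ this)).sub
    (contDiff_const.inner ℝ contDiff_id)).add contDiff_const

theorem differentiable_dq : Differentiable ℝ Q.dq := by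
  have h : ContDiff ℝ 2 Q.q := contDiff_euclidean.2 fun i => Q.contDiff_quad i.succ
  have e : Q.dq = fderiv ℝ Q.q := funext fun z => (Q.hasFDerivAt_q z).fderiv.symm
  rw [e]
  exact (h.fderiv_right (m := 1) (by norm_num)).differentiable (by norm_num)

theorem differentiable_grad (k : Fin (m + 1)) : Differentiable ℝ (Q.grad k) :=
  fun z => (Q.hasFDerivAt_grad k z).differentiableAt

theorem Aσ_apply (σ : EuclideanSpace ℝ (Fin m)) (x : EuclideanSpace ℝ (Fin n)) :
    toEuclideanLin (Q.Aσ σ) x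
      = toEuclideanLin (Q.A 0) x + ∑ i : Fin m, σ i • toEuclideanLin (Q.A i.succ) x := by
  simp [Aσ, LinearMap.sum_apply]

theorem Aσ_add_apply (σ h : EuclideanSpace ℝ (Fin m)) (x : EuclideanSpace ℝ (Fin n)) :
    toEuclideanLin (Q.Aσ (σ + h)) x = toEuclideanLin (Q.Aσ σ) x
      + ∑ i : Fin m, h i • toEuclideanLin (Q.A i.succ) x := by
  simp [Aσ_apply, add_smul, Finset.sum_add_distrib, add_assoc]

theorem bσ_add (σ h : EuclideanSpace ℝ (Fin m)) :
    Q.bσ (σ + h) = Q.bσ σ + ∑ i : Fin m, h i • Q.b i.succ := by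
  simp [bσ, add_smul, Finset.sum_add_distrib, add_assoc]

/-- The gradient `∑ h_i (A_i x - b_i)` of `⟨q(x), h⟩` in `x`. -/
def gradSum (x : EuclideanSpace ℝ (Fin n)) (h : EuclideanSpace ℝ (Fin m)) :
    EuclideanSpace ℝ (Fin n) := ∑ i : Fin m, h i • Q.grad i.succ x

theorem Aσ_add_sub_bσ_add (σ h : EuclideanSpace ℝ (Fin m)) (x : EuclideanSpace ℝ (Fin n)) :
    toEuclideanLin (Q.Aσ (σ + h)) x - Q.bσ (σ + h)
      = toEuclideanLin (Q.Aσ σ) x - Q.bσ σ + Q.gradSum x h := by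
  simp only [Aσ_add_apply, bσ_add, gradSum, grad, smul_sub, Finset.sum_sub_distrib]
  abel

theorem grad_zero_add_gradSum (σ : EuclideanSpace ℝ (Fin m)) (x : EuclideanSpace ℝ (Fin n)) :
    Q.grad 0 x + Q.gradSum x σ = toEuclideanLin (Q.Aσ σ) x - Q.bσ σ := by
  simp only [Aσ_apply, bσ, gradSum, grad, smul_sub, Finset.sum_sub_distrib]
  abel

theorem L_add_left (x u : EuclideanSpace ℝ (Fin n)) (σ : EuclideanSpace ℝ (Fin m)) :
    Q.L (x + u) σ = Q.L x σ + inner ℝ (toEuclideanLin (Q.Aσ σ) x - Q.bσ σ) u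
      + 1 / 2 * inner ℝ u (toEuclideanLin (Q.Aσ σ) u) := by
  have h := inner_toEuclideanLin_of_isSymm (Q.Aσ_isSymm σ) x u
  have h2 := inner_toEuclideanLin_of_isSymm (Q.Aσ_isSymm σ) u x
  simp only [L_eq, map_add, inner_add_left, inner_add_right, inner_sub_left]
  rw [real_inner_comm] at h2
  linarith

theorem L_add_right (x : EuclideanSpace ℝ (Fin n)) (σ h : EuclideanSpace ℝ (Fin m)) :
    Q.L x (σ + h) = Q.L x σ + inner ℝ (Q.q x) h := by
  simp [L, inner_add_right, add_assoc]

/-- The second derivative of `q₀ + g ∘ q`. -/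
theorem hasFDerivAt_fderiv_comp {g : EuclideanSpace ℝ (Fin m) → ℝ}
    {g' : EuclideanSpace ℝ (Fin m) → EuclideanSpace ℝ (Fin m) →L[ℝ] ℝ}
    {B : EuclideanSpace ℝ (Fin m) →L[ℝ] EuclideanSpace ℝ (Fin m) →L[ℝ] ℝ}
    {x : EuclideanSpace ℝ (Fin n)} {σ : EuclideanSpace ℝ (Fin m)}
    (hg : ∀ᶠ y in 𝓝 (Q.q x), HasFDerivAt g (g' y) y) (hB : HasFDerivAt g' B (Q.q x))
    (hσ : g' (Q.q x) = innerSL ℝ σ) :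
    ∃ (f' : EuclideanSpace ℝ (Fin n) → EuclideanSpace ℝ (Fin n) →L[ℝ] ℝ)
      (T : EuclideanSpace ℝ (Fin n) →L[ℝ] EuclideanSpace ℝ (Fin n) →L[ℝ] ℝ),
      (∀ᶠ z in 𝓝 x, HasFDerivAt (fun z => Q.quad 0 z + g (Q.q z)) (f' z) z) ∧
      HasFDerivAt f' T x ∧ f' x = innerSL ℝ (toEuclideanLin (Q.Aσ σ) x - Q.bσ σ) ∧
      ∀ u v, T u v = inner ℝ (toEuclideanLin (Q.Aσ σ) u) v + B (Q.dq x u) (Q.dq x v) := by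
  set f' : EuclideanSpace ℝ (Fin n) → EuclideanSpace ℝ (Fin n) →L[ℝ] ℝ :=
    fun z => innerSL ℝ (Q.grad 0 z) + (g' (Q.q z)).comp (Q.dq z) with hf'
  have hg'q : HasFDerivAt (fun z => g' (Q.q z)) (B.comp (Q.dq x)) x := hB.comp x (Q.hasFDerivAt_q x)
  have hd : DifferentiableAt ℝ f' x :=
    ((innerSL ℝ).differentiableAt.comp x (Q.differentiable_grad 0 x)).add
      (hg'q.differentiableAt.clm_comp (Q.differentiable_dq x))
  refine ⟨f', fderiv ℝ f' x, ?_, hd.hasFDerivAt, ?_, fun u v => ?_⟩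
  · filter_upwards [(Q.hasFDerivAt_q x).continuousAt.eventually hg] with z hz
    exact (Q.hasFDerivAt_quad 0 z).add (hz.comp z (Q.hasFDerivAt_q z))
  · ext u
    rw [← grad_zero_add_gradSum]
    simp only [hf', hσ, _root_.add_apply, ContinuousLinearMap.comp_apply,
      innerSL_apply_apply, dq, inner_innerFamily, inner_add_left, gradSum]
  -- Differentiability of `f'` being known, its derivative is read off by evaluating at a fixed `v`.
  · have h1 : HasFDerivAt (fun z => f' z v) ((fderiv ℝ f' x).flip v) x := by
      have := hd.hasFDerivAt.clm_apply (hasFDerivAt_const v x)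
      simpa using this
    have h2 := ((Q.hasFDerivAt_grad 0 x).inner ℝ (hasFDerivAt_const v x)).add
      (hg'q.clm_apply (Q.hasFDerivAt_dq_apply v x))
    have h3 := DFunLike.congr_fun (h1.unique h2) u
    rw [ContinuousLinearMap.flip_apply] at h3
    rw [h3, Aσ_apply]
    have e : inner ℝ σ (innerFamily (fun i : Fin m => toEuclideanLin (Q.A i.succ) v) u)
        = inner ℝ (∑ i : Fin m, σ i • toEuclideanLin (Q.A i.succ) u) v := by
      simp only [inner_innerFamily, sum_inner, real_inner_smul_left]
      refine Finset.sum_congr rfl fun i _ => ?_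
      rw [inner_toEuclideanLin_of_isSymm (Q.symm _), real_inner_comm]
    simp only [inner_add_left, ← e]
    simp [hσ]
    ring

end QuadFamily

open Matrix Asymptotics Filter

/-! ### From extended-real to real local extrema, and from the sphere to all vectors. -/

section Transfer

variable {X : Type*} [TopologicalSpace X] {φ : X → EReal} {ψ : X → ℝ} {S : Set X} {a : X}

theorem isLocalMaxOn_iff_of_eventuallyEq_coe (hS : S ∈ 𝓝 a)
    (h : ∀ᶠ w in 𝓝 a, φ w = (ψ w : EReal)) : IsLocalMaxOn φ S a ↔ IsLocalMax ψ a := by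
  rw [IsLocalMaxOn, IsMaxFilter, nhdsWithin_eq_nhds.2 hS, IsLocalMax, IsMaxFilter]
  refine eventually_congr ?_
  filter_upwards [h] with w hw
  rw [hw, h.self_of_nhds, EReal.coe_le_coe_iff]

theorem isLocalMinOn_iff_of_eventuallyEq_coe (hS : S ∈ 𝓝 a)
    (h : ∀ᶠ w in 𝓝 a, φ w = (ψ w : EReal)) : IsLocalMinOn φ S a ↔ IsLocalMin ψ a := by
  rw [IsLocalMinOn, IsMinFilter, nhdsWithin_eq_nhds.2 hS, IsLocalMin, IsMinFilter]
  refine eventually_congr ?_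
  filter_upwards [h] with w hw
  rw [hw, h.self_of_nhds, EReal.coe_le_coe_iff]

end Transfer

theorem sphere_norm_lt_iff {U W : Type*} [NormedAddCommGroup U] [NormedSpace ℝ U]
    [NormedAddCommGroup W] [NormedSpace ℝ W] (H : U →ₗ[ℝ] W) :
    (∀ v, ‖v‖ = 1 → ‖H v‖ < 1) ↔ ∀ v, v ≠ 0 → ‖H v‖ < ‖v‖ := by
  refine ⟨fun h v hv => ?_, fun h v hv => ?_⟩
  · have hn : 0 < ‖v‖ := norm_pos_iff.2 hv
    have := h (‖v‖⁻¹ • v) (by rw [norm_smul, norm_inv, norm_norm, inv_mul_cancel₀ hn.ne'])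
    rwa [map_smul, norm_smul, norm_inv, norm_norm, inv_mul_lt_iff₀ hn, mul_one] at this
  · have h0 : v ≠ 0 := by
      rintro rfl
      simp at hv
    simpa [hv] using h v h0

theorem sphere_lt_norm_iff {U W : Type*} [NormedAddCommGroup U] [NormedSpace ℝ U]
    [NormedAddCommGroup W] [NormedSpace ℝ W] (H : U →ₗ[ℝ] W) :
    (∀ v, ‖v‖ = 1 → 1 < ‖H v‖) ↔ ∀ v, v ≠ 0 → ‖v‖ < ‖H v‖ := by
  refine ⟨fun h v hv => ?_, fun h v hv => ?_⟩
  · have hn : 0 < ‖v‖ := norm_pos_iff.2 hv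
    have := h (‖v‖⁻¹ • v) (by rw [norm_smul, norm_inv, norm_norm, inv_mul_cancel₀ hn.ne'])
    rwa [map_smul, norm_smul, norm_inv, norm_norm, lt_inv_mul_iff₀ hn, mul_one] at this
  · have h0 : v ≠ 0 := by
      rintro rfl
      simp at hv
    simpa [hv] using h v h0

theorem isUnit_det_of_transpose_mul_posDef {k : ℕ} {M P : Matrix (Fin k) (Fin k) ℝ}
    (hP : P.PosDef) (h : Mᵀ * M = P) : IsUnit M.det := by
  have := hP.det_pos
  rw [← h, det_mul, det_transpose] at this
  exact isUnit_iff_ne_zero.2 fun h0 => by simp [h0] at this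

/-! ### Critical point equations and expansion of the dual function. -/

namespace QuadFamily

variable {n m : ℕ} (Q : QuadFamily n m) {V : EuclideanSpace ℝ (Fin m) → EReal}

theorem hasFDerivAt_L_left (x : EuclideanSpace ℝ (Fin n)) (σ : EuclideanSpace ℝ (Fin m)) :
    HasFDerivAt (fun z => Q.L z σ) (innerSL ℝ (toEuclideanLin (Q.Aσ σ) x - Q.bσ σ)) x := by
  simp only [L_eq]
  exact hasFDerivAt_quadratic (Q.Aσ_isSymm σ) _ _ x

theorem hasFDerivAt_L_right (x : EuclideanSpace ℝ (Fin n)) (σ : EuclideanSpace ℝ (Fin m)) :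
    HasFDerivAt (fun w => Q.L x w) (innerSL ℝ (Q.q x)) σ :=
  (innerSL ℝ (Q.q x)).hasFDerivAt.const_add (Q.quad 0 x)

theorem Xi_eq_coe (x : EuclideanSpace ℝ (Fin n)) {σ : EuclideanSpace ℝ (Fin m)}
    (h1 : conj V σ ≠ ⊤) (h2 : conj V σ ≠ ⊥) :
    Q.Xi V (x, σ) = ((Q.L x σ - (conj V σ).toReal : ℝ) : EReal) := by
  rw [EReal.coe_sub, EReal.coe_toReal h1 h2, Xi]

/-- The critical point equations. -/
theorem critical_equations {x : EuclideanSpace ℝ (Fin n)} {σ : EuclideanSpace ℝ (Fin m)}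
    (hcrit : IsCriticalPoint (Q.Xi V) (x, σ)) :
    toEuclideanLin (Q.Aσ σ) x = Q.bσ σ ∧ (∀ᶠ w in 𝓝 σ, conj V w ≠ ⊤ ∧ conj V w ≠ ⊥) ∧
      HasFDerivAt (fun w => (conj V w).toReal) (innerSL ℝ (Q.q x)) σ := by
  obtain ⟨hfin, hd⟩ := hcrit
  have hfin' : ∀ᶠ w in 𝓝 σ, conj V w ≠ ⊤ ∧ conj V w ≠ ⊥ := by
    have ht : Tendsto (fun w : EuclideanSpace ℝ (Fin m) => (x, w)) (𝓝 σ) (𝓝 (x, σ)) :=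
      Continuous.tendsto (by fun_prop) _
    filter_upwards [ht.eventually hfin] with w hw
    refine ⟨fun h => hw.2 ?_, fun h => hw.1 ?_⟩ <;> simp [Xi, h]
  refine ⟨?_, hfin', ?_⟩
  · have h1 : HasFDerivAt (fun z => (Q.Xi V (z, σ)).toReal)
        (0 : EuclideanSpace ℝ (Fin n) →L[ℝ] ℝ) x := by
      have := HasFDerivAt.comp (f := fun z => (z, σ)) x hd (hasFDerivAt_prodMk_left x σ)
      simpa [Function.comp_def] using this
    have h2 : HasFDerivAt (fun z => (Q.Xi V (z, σ)).toReal)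
        (innerSL ℝ (toEuclideanLin (Q.Aσ σ) x - Q.bσ σ)) x := by
      simp only [fun z => Q.Xi_eq_coe z hfin'.self_of_nhds.1 hfin'.self_of_nhds.2, EReal.toReal_coe]
      exact (Q.hasFDerivAt_L_left x σ).sub_const _
    have h3 := h2.unique h1
    rw [← sub_eq_zero, ← inner_self_eq_zero (𝕜 := ℝ), ← innerSL_apply_apply ℝ, h3]
    rfl
  · have h1 : HasFDerivAt (fun w => (Q.Xi V (x, w)).toReal)
        (0 : EuclideanSpace ℝ (Fin m) →L[ℝ] ℝ) σ := by
      have := HasFDerivAt.comp (f := fun w => (x, w)) σ hd (hasFDerivAt_prodMk_right x σ)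
      simpa [Function.comp_def] using this
    -- Near `σ`, `V* = L(x, ·) - Ξ(x, ·)`, and the second term has zero derivative.
    have h2 := (Q.hasFDerivAt_L_right x σ).sub h1
    rw [sub_zero] at h2
    refine h2.congr_of_eventuallyEq ?_
    filter_upwards [hfin'] with w hw
    rw [Pi.sub_apply, Q.Xi_eq_coe x hw.1 hw.2, EReal.toReal_coe]
    ring

theorem norm_gradSum_le (x : EuclideanSpace ℝ (Fin n)) (h : EuclideanSpace ℝ (Fin m)) :
    ‖Q.gradSum x h‖ ≤ (∑ i : Fin m, ‖Q.grad i.succ x‖) * ‖h‖ := by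
  rw [gradSum, Finset.sum_mul]
  refine (norm_sum_le _ _).trans (Finset.sum_le_sum fun i _ => ?_)
  rw [norm_smul, mul_comm]
  gcongr
  exact PiLp.norm_apply_le h i

theorem J_apply (E : Matrix (Fin n) (Fin n) ℝ) (x : EuclideanSpace ℝ (Fin n))
    (h : EuclideanSpace ℝ (Fin m)) :
    Q.J E x h = toEuclideanLin (E⁻¹)ᵀ (Q.gradSum x h) := by
  simp only [gradSum, map_sum, map_smul]
  rfl

theorem continuous_toEuclideanCLM_Aσ :
    Continuous fun σ => toEuclideanCLM (𝕜 := ℝ) (Q.Aσ σ) := by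
  simp only [Aσ, map_add, map_sum, map_smul]
  fun_prop

/-- As `A(σ) = -EᵀE`, `J h = E⁻ᵀ A(σ) w = -E w`. Thus `‖J h‖²` is the form of `-A(σ)⁻¹` at `gradSum
x h`. -/
theorem norm_J_sq {E : Matrix (Fin n) (Fin n) ℝ} (hEu : IsUnit E.det)
    {σ : EuclideanSpace ℝ (Fin m)} (hE : Eᵀ * E = -Q.Aσ σ) (x : EuclideanSpace ℝ (Fin n))
    (h : EuclideanSpace ℝ (Fin m)) {w : EuclideanSpace ℝ (Fin n)}
    (hw : toEuclideanLin (Q.Aσ σ) w = Q.gradSum x h) :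
    ‖Q.J E x h‖ ^ 2 = -inner ℝ (Q.gradSum x h) w := by
  have h1 : Q.gradSum x h = -toEuclideanLin Eᵀ (toEuclideanLin E w) := by
    rw [← toEuclideanLin_mul_apply, hE, map_neg, LinearMap.neg_apply, neg_neg, hw]
  have h2 : Q.J E x h = -toEuclideanLin E w := by
    rw [J_apply, h1, map_neg, ← toEuclideanLin_mul_apply, ← transpose_mul, mul_nonsing_inv _ hEu,
      transpose_one, toEuclideanLin_one_apply]
  rw [h2, norm_neg, h1, inner_neg_left, neg_neg, inner_toEuclideanLin_transpose,
    real_inner_self_eq_norm_sq]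

/-- The second-order expansion of the dual function at a critical point, given one of `V*`. -/
theorem dual_isLittleO {x : EuclideanSpace ℝ (Fin n)} {σ : EuclideanSpace ℝ (Fin m)}
    (hA : IsUnit (Q.Aσ σ)) (hx : toEuclideanLin (Q.Aσ σ) x = Q.bσ σ)
    (hfin : ∀ᶠ w in 𝓝 σ, conj V w ≠ ⊤ ∧ conj V w ≠ ⊥)
    {E : Matrix (Fin n) (Fin n) ℝ} (hEu : IsUnit E.det) (hE : Eᵀ * E = -Q.Aσ σ)
    {G : EuclideanSpace ℝ (Fin m) →L[ℝ] EuclideanSpace ℝ (Fin m)}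
    (hconj : (fun h => (conj V (σ + h)).toReal - (conj V σ).toReal - inner ℝ (Q.q x) h
      - 1 / 2 * ‖G h‖ ^ 2) =o[𝓝 0] fun h => ‖h‖ ^ 2) :
    Q.Scol V ∈ 𝓝 σ ∧ (∀ᶠ w in 𝓝 σ, Q.D V w = ((Q.D V w).toReal : EReal)) ∧
      (fun h => (Q.D V (σ + h)).toReal - (Q.D V σ).toReal - 1 / 2 * (‖Q.J E x h‖ ^ 2 - ‖G h‖ ^ 2))
        =o[𝓝 0] fun h => ‖h‖ ^ 2 := by
  set T : EuclideanSpace ℝ (Fin m) → EuclideanSpace ℝ (Fin n) →L[ℝ] EuclideanSpace ℝ (Fin n) :=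
    fun w => toEuclideanCLM (𝕜 := ℝ) (Q.Aσ w) with hT
  have hTσ : IsUnit (T σ) := hA.map (toEuclideanCLM (𝕜 := ℝ))
  have hTu : ∀ᶠ w in 𝓝 σ, IsUnit (T w) :=
    Q.continuous_toEuclideanCLM_Aσ.continuousAt.eventually (Units.isOpen.mem_nhds hTσ)
  have hTR : ∀ w, IsUnit (T w) → ∀ u, toEuclideanLin (Q.Aσ w) (Ring.inverse (T w) u) = u := by
    intro w hw u
    exact DFunLike.congr_fun (Ring.mul_inverse_cancel _ hw) u
  have hσt : Tendsto (fun k : EuclideanSpace ℝ (Fin m) => σ + k) (𝓝 0) (𝓝 σ) := by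
    simpa using (continuous_const_add σ).tendsto (0 : EuclideanSpace ℝ (Fin m))
  have hsol : ∀ w, IsUnit (T w) → ∃ z, toEuclideanLin (Q.Aσ w) z = Q.bσ w :=
    fun w hw => ⟨_, hTR w hw _⟩
  have hDσ : Q.D V σ = ((Q.L x σ - (conj V σ).toReal : ℝ) : EReal) := by
    rw [Q.D_eq V hx, Q.Xi_eq_coe x hfin.self_of_nhds.1 hfin.self_of_nhds.2]
  refine ⟨?_, ?_, ?_⟩
  · filter_upwards [hTu, hfin] with w hw hf
    exact ⟨hsol w hw, lt_top_iff_ne_top.2 hf.1⟩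
  · filter_upwards [hTu, hfin] with w hw hf
    obtain ⟨z, hz⟩ := hsol w hw
    rw [Q.D_eq V hz, Q.Xi_eq_coe z hf.1 hf.2, EReal.toReal_coe]
  · have hR : Tendsto (fun h => Ring.inverse (T (σ + h)) - Ring.inverse (T σ)) (𝓝 0) (𝓝 0) := by
      have h1 : Tendsto Ring.inverse (𝓝 (T σ)) (𝓝 (Ring.inverse (T σ))) := by
        obtain ⟨u, hu⟩ := hTσ
        rw [← hu]
        exact NormedRing.inverse_continuousAt u
      have h2 : Tendsto T (𝓝 σ) (𝓝 (T σ)) := Q.continuous_toEuclideanCLM_Aσ.tendsto σ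
      simpa using ((h1.comp h2).comp hσt).sub_const (Ring.inverse (T σ))
    -- Replacing `A(σ+h)⁻¹` by `A(σ)⁻¹` costs `o(‖h‖²)`: inversion is continuous and `gradSum x h`
    -- is `O(‖h‖)`.
    have hquad : (fun h => inner ℝ (Q.gradSum x h)
        ((Ring.inverse (T (σ + h)) - Ring.inverse (T σ)) (Q.gradSum x h)))
        =o[𝓝 0] fun h => ‖h‖ ^ 2 := by
      set c := ∑ i : Fin m, ‖Q.grad i.succ x‖
      have hc : 0 ≤ c := Finset.sum_nonneg fun i _ => norm_nonneg _
      rw [isLittleO_iff]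
      intro ε hε
      have hε' : 0 < ε / (c ^ 2 + 1) := by positivity
      filter_upwards [hR.eventually (Metric.ball_mem_nhds 0 hε')] with h hh
      have hh' := (mem_ball_zero_iff.1 hh).le
      set K := Ring.inverse (T (σ + h)) - Ring.inverse (T σ)
      have hg := Q.norm_gradSum_le x h
      rw [norm_pow, norm_norm]
      calc ‖inner ℝ (Q.gradSum x h) (K (Q.gradSum x h))‖
          ≤ ‖Q.gradSum x h‖ * ‖K (Q.gradSum x h)‖ := norm_inner_le_norm _ _
        _ ≤ ‖Q.gradSum x h‖ * (‖K‖ * ‖Q.gradSum x h‖) := by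
            gcongr
            exact K.le_opNorm _
        _ = ‖K‖ * ‖Q.gradSum x h‖ ^ 2 := by ring
        _ ≤ ε / (c ^ 2 + 1) * (c * ‖h‖) ^ 2 := by gcongr
        _ = ε * (c ^ 2 / (c ^ 2 + 1)) * ‖h‖ ^ 2 := by ring
        _ ≤ ε * 1 * ‖h‖ ^ 2 := by
            gcongr
            rw [div_le_one (by positivity)]
            linarith
        _ = ε * ‖h‖ ^ 2 := by ring
    refine ((hquad.const_mul_left (-(1 / 2))).sub hconj).congr' ?_ EventuallyEq.rfl
    filter_upwards [hσt.eventually hTu, hσt.eventually hfin] with h hu hf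
    set r := Ring.inverse (T (σ + h)) (Q.gradSum x h) with hr
    have hAr : toEuclideanLin (Q.Aσ (σ + h)) r = Q.gradSum x h := hTR _ hu _
    have hres : toEuclideanLin (Q.Aσ (σ + h)) x - Q.bσ (σ + h) = Q.gradSum x h := by
      rw [Aσ_add_sub_bσ_add, hx, sub_self, zero_add]
    -- The residual of `x` at `σ + h` is `gradSum x h`, so `x - r` solves the perturbed equation
    -- exactly.
    have hz : toEuclideanLin (Q.Aσ (σ + h)) (x + -r) = Q.bσ (σ + h) := by
      rw [map_add, map_neg, hAr, ← hres]
      abel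
    have hL : Q.L (x + -r) (σ + h)
        = Q.L x σ + inner ℝ (Q.q x) h - 1 / 2 * inner ℝ (Q.gradSum x h) r := by
      rw [L_add_left, L_add_right, hres, map_neg, hAr, inner_neg_neg, inner_neg_right,
        real_inner_comm r]
      ring
    rw [Q.D_eq V hz, Q.Xi_eq_coe _ hf.1 hf.2, hDσ, EReal.toReal_coe, EReal.toReal_coe, hL,
      Q.norm_J_sq hEu hE x h (hTR σ hTσ (Q.gradSum x h)), _root_.sub_apply, inner_sub_right, ← hr]
    ring

end QuadFamily

open Matrix Asymptotics Filter

/-! ### Expansion of the primal function. -/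

namespace QuadFamily

variable {n m : ℕ} (Q : QuadFamily n m) {V : EuclideanSpace ℝ (Fin m) → EReal}

/-- `H = E⁻ᵀ Dqᵀ Fᵀ`, hence `Hᵀ E = F Dq`. -/
theorem adjoint_H_apply {E : Matrix (Fin n) (Fin n) ℝ} (hEu : IsUnit E.det)
    (F : Matrix (Fin m) (Fin m) ℝ) (x u : EuclideanSpace ℝ (Fin n)) :
    (Q.H E F x).adjoint (toEuclideanLin E u) = toEuclideanLin F (Q.dq x u) := by
  refine ext_inner_right ℝ fun v => ?_
  rw [LinearMap.adjoint_inner_left, H, LinearMap.comp_apply, J_apply, real_inner_comm,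
    inner_toEuclideanLin_transpose, ← toEuclideanLin_mul_apply, nonsing_inv_mul _ hEu,
    toEuclideanLin_one_apply, gradSum, ← inner_innerFamily, inner_toEuclideanLin_transpose,
    real_inner_comm]
  rfl

/-- Near a point of `X₀` the primal function is finite, and its second derivative at a critical
point is `(u, v) ↦ ⟨(H H* - 1) E u, E v⟩`. -/
theorem primal_expansion {x : EuclideanSpace ℝ (Fin n)} {σ : EuclideanSpace ℝ (Fin m)}
    (hb : ∀ y, V y ≠ ⊥) (hx : x ∈ Q.X0 V) {B : EuclideanSpace ℝ (Fin m) →L[ℝ]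
      EuclideanSpace ℝ (Fin m) →L[ℝ] ℝ}
    {V' : EuclideanSpace ℝ (Fin m) → EuclideanSpace ℝ (Fin m) →L[ℝ] ℝ}
    (hV' : ∀ᶠ y in 𝓝 (Q.q x), HasFDerivAt (fun y => (V y).toReal) (V' y) y)
    (hB : HasFDerivAt V' B (Q.q x)) (hVσ : V' (Q.q x) = innerSL ℝ σ)
    (hAx : toEuclideanLin (Q.Aσ σ) x = Q.bσ σ)
    {E : Matrix (Fin n) (Fin n) ℝ} (hEu : IsUnit E.det) (hE : Eᵀ * E = -Q.Aσ σ)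
    {F : Matrix (Fin m) (Fin m) ℝ}
    (hF : ∀ u v, B u v = inner ℝ (toEuclideanLin F u) (toEuclideanLin F v)) :
    (∀ᶠ z in 𝓝 x, Q.f V z = ((Q.f V z).toReal : EReal)) ∧
      (∀ u v, fderiv ℝ (fderiv ℝ fun z => (Q.f V z).toReal) x u v
        = inner ℝ (Q.H E F x ((Q.H E F x).adjoint (toEuclideanLin E u)) - toEuclideanLin E u)
          (toEuclideanLin E v)) ∧
      (fun u => (Q.f V (x + u)).toReal - (Q.f V x).toReal
        - 1 / 2 * (‖(Q.H E F x).adjoint (toEuclideanLin E u)‖ ^ 2 - ‖toEuclideanLin E u‖ ^ 2))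
        =o[𝓝 0] fun u => ‖u‖ ^ 2 := by
  have hdom : ∀ᶠ z in 𝓝 x, Q.q z ∈ edom V :=
    (Q.hasFDerivAt_q x).continuousAt.eventually (mem_interior_iff_mem_nhds.1 hx)
  have hf : ∀ᶠ z in 𝓝 x, Q.f V z = ((Q.quad 0 z + (V (Q.q z)).toReal : ℝ) : EReal) := by
    filter_upwards [hdom] with z hz
    rw [f, EReal.coe_add, coe_toReal_of_mem_edom hb hz]
  have hfr : ∀ᶠ z in 𝓝 x, (Q.f V z).toReal = Q.quad 0 z + (V (Q.q z)).toReal := by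
    filter_upwards [hf] with z hz
    rw [hz, EReal.toReal_coe]
  obtain ⟨f', T, hf', hT, hf'x, hTB⟩ := Q.hasFDerivAt_fderiv_comp hV' hB hVσ
  have hfd : ∀ᶠ z in 𝓝 x, HasFDerivAt (fun z => (Q.f V z).toReal) (f' z) z := by
    filter_upwards [hf', hfr.eventually_nhds] with z hz hz'
    exact hz.congr_of_eventuallyEq hz'
  have hTe : ∀ u v, T u v
      = inner ℝ (Q.H E F x ((Q.H E F x).adjoint (toEuclideanLin E u)) - toEuclideanLin E u)
          (toEuclideanLin E v) := by
    intro u v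
    have hAe : Q.Aσ σ = -(Eᵀ * E) := by rw [hE, neg_neg]
    rw [hTB, hF, inner_sub_left, ← LinearMap.adjoint_inner_right (Q.H E F x), Q.adjoint_H_apply hEu,
      Q.adjoint_H_apply hEu, hAe, map_neg, LinearMap.neg_apply, inner_neg_left,
      toEuclideanLin_mul_apply, inner_toEuclideanLin_transpose]
    ring
  refine ⟨?_, ?_, ?_⟩
  · filter_upwards [hf] with z hz
    rw [hz, EReal.toReal_coe]
  · have : fderiv ℝ (fun z => (Q.f V z).toReal) =ᶠ[𝓝 x] f' := by
      filter_upwards [hfd] with z hz using hz.fderiv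
    rw [(hT.congr_of_eventuallyEq this).fderiv]
    exact hTe
  · refine (taylor_two_isLittleO hfd hT).congr_left fun u => ?_
    rw [hf'x, hAx, sub_self, map_zero, hTe, real_inner_comm, norm_adjoint_sq_sub]
    simp

end QuadFamily

end CanonicalDuality

end

/-! ### The main theorem. -/

open CanonicalDuality Matrix

theorem corollary5p2 {n m : ℕ} (Q : CanonicalDuality.QuadFamily n m)
    (V : EuclideanSpace ℝ (Fin m) → EReal) (hV : CanonicalDuality.IsGammaSC2 V)
    (x : EuclideanSpace ℝ (Fin n)) (σ : EuclideanSpace ℝ (Fin m))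
    (hx : x ∈ Q.X0 V) (hσ : σ ∈ Q.Sneg V)
    (hcrit : CanonicalDuality.IsCriticalPoint (Q.Xi V) (x, σ))
    (hdet : (CanonicalDuality.hessian (fun z => (Q.f V z).toReal) x).det ≠ 0)
    (E : Matrix (Fin n) (Fin n) ℝ) (hE : Eᵀ * E = -Q.Aσ σ)
    (F : Matrix (Fin m) (Fin m) ℝ)
    (hF : Fᵀ * F = CanonicalDuality.hessian (fun y => (V y).toReal) (Q.q x)) :
    ((IsLocalMax (Q.f V) x ↔ ∀ v : EuclideanSpace ℝ (Fin m), ‖v‖ = 1 → ‖Q.H E F x v‖ < 1) ∧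
      ((∀ v : EuclideanSpace ℝ (Fin m), ‖v‖ = 1 → ‖Q.H E F x v‖ < 1) ↔
        IsLocalMaxOn (Q.D V) (Q.Scol V) σ)) ∧
    (m = n →
      (IsLocalMin (Q.f V) x ↔ ∀ v : EuclideanSpace ℝ (Fin m), ‖v‖ = 1 → 1 < ‖Q.H E F x v‖) ∧
      ((∀ v : EuclideanSpace ℝ (Fin m), ‖v‖ = 1 → 1 < ‖Q.H E F x v‖) ↔
        IsLocalMinOn (Q.D V) (Q.Scol V) σ)) := by
  have hEu : IsUnit E.det := isUnit_det_of_transpose_mul_posDef hσ.1 hE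
  have hFu : IsUnit F.det := isUnit_det_of_transpose_mul_posDef (hV.hessian_posDef _ hx) hF
  have hAu : IsUnit (Q.Aσ σ) := by
    have h := (isUnit_iff_isUnit_det _).2 hσ.1.det_pos.ne'.isUnit
    simpa using h.neg
  obtain ⟨hAx, hfin, hcd⟩ := Q.critical_equations hcrit
  have hqx : edom V ∈ 𝓝 (Q.q x) := mem_interior_iff_mem_nhds.1 hx
  have hV' : ∀ᶠ y in 𝓝 (Q.q x), HasFDerivAt (fun y => (V y).toReal)
      (fderiv ℝ (fun y => (V y).toReal) y) y := by
    filter_upwards [isOpen_interior.mem_nhds hx] with y hy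
    exact (hV.essentiallySmooth.differentiableOn.differentiableAt
      (isOpen_interior.mem_nhds hy)).hasFDerivAt
  have hB := (hV.twice_differentiable _ hx).hasFDerivAt
  obtain ⟨hVσ, hcσ⟩ : fderiv ℝ (fun y => (V y).toReal) (Q.q x) = innerSL ℝ σ ∧
      (conj V σ).toReal = inner ℝ (Q.q x) σ - (V (Q.q x)).toReal := by
    obtain ⟨τ, hτ⟩ := (InnerProductSpace.toDual ℝ _).surjective
      (fderiv ℝ (fun y => (V y).toReal) (Q.q x))
    have hτ' : fderiv ℝ (fun y => (V y).toReal) (Q.q x) = innerSL ℝ τ := hτ.symm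
    have h := hV'.self_of_nhds
    rw [hτ'] at h
    obtain ⟨rfl, h2⟩ := gradient_conj_gradient hV.toIsGamma hqx h hfin hcd
    exact ⟨hτ', h2⟩
  have hFB : ∀ u v, fderiv ℝ (fderiv ℝ fun y => (V y).toReal) (Q.q x) u v
      = inner ℝ (toEuclideanLin F u) (toEuclideanLin F v) := by
    intro u v
    rw [bilin_eq_inner_toEuclideanLin]
    change inner ℝ u (toEuclideanLin (hessian (fun y => (V y).toReal) (Q.q x)) v) = _
    rw [← hF, toEuclideanLin_mul_apply, real_inner_comm, inner_toEuclideanLin_transpose,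
      real_inner_comm]
  obtain ⟨hfcoe, hfhess, hfexp⟩ :=
    Q.primal_expansion hV.ne_bot hx hV' hB hVσ hAx hEu hE hFB
  -- `GᵀG` is the inverse of `∇²V(q(x))`, the Hessian form of `V*`.
  set G := toEuclideanCLM (𝕜 := ℝ) (F⁻¹)ᵀ with hG
  have hGF : ∀ v, G (toEuclideanLin Fᵀ v) = v := fun v => by
    change toEuclideanLin (F⁻¹)ᵀ _ = _
    rw [← toEuclideanLin_mul_apply, ← transpose_mul, mul_nonsing_inv _ hFu, transpose_one,
      toEuclideanLin_one_apply]
  have hFG : ∀ h, toEuclideanLin Fᵀ (G h) = h := fun h => by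
    change toEuclideanLin Fᵀ (toEuclideanLin (F⁻¹)ᵀ _) = _
    rw [← toEuclideanLin_mul_apply, ← transpose_mul, nonsing_inv_mul _ hFu, transpose_one,
      toEuclideanLin_one_apply]
  have hconj := conj_isLittleO (F := toEuclideanCLM (𝕜 := ℝ) F) (G := G)
    (R := toEuclideanCLM (𝕜 := ℝ) F⁻¹) (s := fun w => (conj V w).toReal) hV.convex hqx
    (fun k h => by
      change _ = inner ℝ (toEuclideanLin F k) (G h)
      rw [real_inner_comm (G h), ← inner_toEuclideanLin_transpose, hFG, real_inner_comm])
    (fun w => by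
      change toEuclideanLin F (toEuclideanLin F⁻¹ w) = w
      rw [← toEuclideanLin_mul_apply, mul_nonsing_inv _ hFu, toEuclideanLin_one_apply])
    (fun w => by
      change toEuclideanLin F⁻¹ (toEuclideanLin F w) = w
      rw [← toEuclideanLin_mul_apply, nonsing_inv_mul _ hFu, toEuclideanLin_one_apply])
    ((taylor_two_isLittleO hV' hB).congr_left fun k => by
      rw [hVσ, hFB, real_inner_self_eq_norm_sq]
      rfl)
    (hfin.mono fun w hw => isLUB_conj hV.ne_bot hw.1 hw.2) hcσ
  obtain ⟨hScol, hDcoe, hDexp⟩ := Q.dual_isLittleO hAu hAx hfin hEu hE hconj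
  have hJH : ∀ h, Q.J E x h = Q.H E F x (G h) := fun h => by
    rw [QuadFamily.H, LinearMap.comp_apply, hFG]
  simp only [hJH] at hDexp
  set H := Q.H E F x with hH
  have hEinj : ∀ u, toEuclideanLin E u = 0 → u = 0 := fun u hu => by
    rw [← toEuclideanLin_one_apply u, ← nonsing_inv_mul _ hEu, toEuclideanLin_mul_apply, hu,
      map_zero]
  have hEsurj : ∀ w, toEuclideanLin E (toEuclideanLin E⁻¹ w) = w := fun w => by
    rw [← toEuclideanLin_mul_apply, mul_nonsing_inv _ hEu, toEuclideanLin_one_apply]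
  have hGinj : ∀ u, G u = 0 → u = 0 := fun u hu => by
    rw [← hFG u, hu, map_zero]
  -- A fixed vector `w` of `H Hᵀ` puts `E⁻¹w` in the kernel of `Eᵀ(H Hᵀ - 1)E = ∇²f(x)`.
  have hk : ∀ w, H (H.adjoint w) = w → w = 0 := by
    intro w hw
    have h0 : toEuclideanLin E⁻¹ w = 0 := by
      have hz : ∀ v, fderiv ℝ (fderiv ℝ fun z => (Q.f V z).toReal) x (toEuclideanLin E⁻¹ w) v
          = 0 := fun v => by
        rw [hfhess, hEsurj, hw, sub_self, inner_zero_left]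
      have hz' : toEuclideanLin (hessian (fun z => (Q.f V z).toReal) x)ᵀ (toEuclideanLin E⁻¹ w)
          = 0 := by
        refine ext_inner_right ℝ fun v => ?_
        rw [inner_toEuclideanLin_transpose, inner_zero_left, ← hz v]
        exact (bilin_eq_inner_toEuclideanLin _ _ _).symm
      have hu : IsUnit ((hessian (fun z => (Q.f V z).toReal) x)ᵀ).det := by
        rw [det_transpose]
        exact hdet.isUnit
      rw [← toEuclideanLin_one_apply (toEuclideanLin E⁻¹ w), ← nonsing_inv_mul _ hu,
        toEuclideanLin_mul_apply, hz', map_zero]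
    rw [← hEsurj w, h0, map_zero]
  have hk' : ∀ v, H.adjoint (H v) = v → v = 0 := adjoint_comp_fixed_trivial hk
  have hPhom : ∀ (t : ℝ) u, ‖H.adjoint (toEuclideanLin E (t • u))‖ ^ 2
      - ‖toEuclideanLin E (t • u)‖ ^ 2
      = t ^ 2 * (‖H.adjoint (toEuclideanLin E u)‖ ^ 2 - ‖toEuclideanLin E u‖ ^ 2) := by
    intro t u
    simp only [map_smul, norm_smul, mul_pow, Real.norm_eq_abs, sq_abs]
    ring
  have hDhom : ∀ (t : ℝ) u, ‖H (G (t • u))‖ ^ 2 - ‖G (t • u)‖ ^ 2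
      = t ^ 2 * (‖H (G u)‖ ^ 2 - ‖G u‖ ^ 2) := by
    intro t u
    simp only [map_smul, norm_smul, mul_pow, Real.norm_eq_abs, sq_abs]
    ring
  have hPcont : Continuous fun u => ‖H.adjoint (toEuclideanLin E u)‖ ^ 2
      - ‖toEuclideanLin E u‖ ^ 2 := by
    have h1 := (toEuclideanLin E).continuous_of_finiteDimensional
    have h2 := H.adjoint.continuous_of_finiteDimensional.comp h1
    exact (h2.norm.pow 2).sub (h1.norm.pow 2)
  have hDcont : Continuous fun u => ‖H (G u)‖ ^ 2 - ‖G u‖ ^ 2 := by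
    have h2 := H.continuous_of_finiteDimensional.comp G.continuous
    exact (h2.norm.pow 2).sub (G.continuous.norm.pow 2)
  have hlt : ∀ a b : ℝ, 0 ≤ a → 0 ≤ b → (a ^ 2 - b ^ 2 < 0 ↔ a < b) := fun a b ha hb => by
    rw [sub_neg, pow_lt_pow_iff_left₀ ha hb two_ne_zero]
  have hgt : ∀ a b : ℝ, 0 ≤ a → 0 ≤ b → (0 < a ^ 2 - b ^ 2 ↔ b < a) := fun a b ha hb => by
    rw [sub_pos, pow_lt_pow_iff_left₀ hb ha two_ne_zero]
  have hka : ∀ v, H.adjoint (H.adjoint.adjoint v) = v → v = 0 := by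
    simpa only [LinearMap.adjoint_adjoint] using hk'
  have hmaxf : IsLocalMax (Q.f V) x ↔ ∀ w, w ≠ 0 → ‖H.adjoint w‖ < ‖w‖ := by
    rw [← isLocalMaxOn_univ_iff, isLocalMaxOn_iff_of_eventuallyEq_coe Filter.univ_mem hfcoe]
    refine ⟨fun h w hw => ?_, fun h => ?_⟩
    · rw [← hlt _ _ (norm_nonneg _) (norm_nonneg _)]
      refine norm_adjoint_lt_of_le hk (fun u => ?_) hw
      simpa only [hEsurj] using
        nonpos_of_isLocalMax_of_isLittleO hPhom hfexp h (toEuclideanLin E⁻¹ u)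
    · refine isLocalMax_of_isLittleO_of_neg hPhom hPcont hfexp fun u hu => ?_
      rw [hlt _ _ (norm_nonneg _) (norm_nonneg _)]
      exact h _ fun h0 => hu (hEinj u h0)
  have hminf : IsLocalMin (Q.f V) x ↔ ∀ w, w ≠ 0 → ‖w‖ < ‖H.adjoint w‖ := by
    rw [← isLocalMinOn_univ_iff, isLocalMinOn_iff_of_eventuallyEq_coe Filter.univ_mem hfcoe]
    refine ⟨fun h w hw => ?_, fun h => ?_⟩
    · rw [← hgt _ _ (norm_nonneg _) (norm_nonneg _)]
      refine lt_norm_adjoint_of_le hk (fun u => ?_) hw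
      simpa only [hEsurj] using
        nonneg_of_isLocalMin_of_isLittleO hPhom hfexp h (toEuclideanLin E⁻¹ u)
    · refine isLocalMin_of_isLittleO_of_pos hPhom hPcont hfexp fun u hu => ?_
      rw [hgt _ _ (norm_nonneg _) (norm_nonneg _)]
      exact h _ fun h0 => hu (hEinj u h0)
  have hmaxD : IsLocalMaxOn (Q.D V) (Q.Scol V) σ ↔ ∀ v, v ≠ 0 → ‖H v‖ < ‖v‖ := by
    rw [isLocalMaxOn_iff_of_eventuallyEq_coe hScol hDcoe]
    refine ⟨fun h w hw => ?_, fun h => ?_⟩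
    · rw [← hlt _ _ (norm_nonneg _) (norm_nonneg _), ← LinearMap.adjoint_adjoint H]
      refine norm_adjoint_lt_of_le hka (fun u => ?_) hw
      have := nonpos_of_isLocalMax_of_isLittleO hDhom hDexp h (toEuclideanLin Fᵀ u)
      rwa [hGF, ← LinearMap.adjoint_adjoint H] at this
    · refine isLocalMax_of_isLittleO_of_neg hDhom hDcont hDexp fun u hu => ?_
      rw [hlt _ _ (norm_nonneg _) (norm_nonneg _)]
      exact h _ fun h0 => hu (hGinj u h0)
  have hminD : IsLocalMinOn (Q.D V) (Q.Scol V) σ ↔ ∀ v, v ≠ 0 → ‖v‖ < ‖H v‖ := by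
    rw [isLocalMinOn_iff_of_eventuallyEq_coe hScol hDcoe]
    refine ⟨fun h w hw => ?_, fun h => ?_⟩
    · rw [← hgt _ _ (norm_nonneg _) (norm_nonneg _), ← LinearMap.adjoint_adjoint H]
      refine lt_norm_adjoint_of_le hka (fun u => ?_) hw
      have := nonneg_of_isLocalMin_of_isLittleO hDhom hDexp h (toEuclideanLin Fᵀ u)
      rwa [hGF, ← LinearMap.adjoint_adjoint H] at this
    · refine isLocalMin_of_isLittleO_of_pos hDhom hDcont hDexp fun u hu => ?_
      rw [hgt _ _ (norm_nonneg _) (norm_nonneg _)]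
      exact h _ fun h0 => hu (hGinj u h0)
  rw [sphere_norm_lt_iff, sphere_lt_norm_iff, hmaxf, hmaxD, hminf, hminD]
  -- The dual criterion already concerns `H`; only the primal one, on `Hᵀ`, has to be transferred.
  refine ⟨⟨⟨fun h v hv => norm_lt_of_norm_adjoint_lt h hv, fun h w hw => ?_⟩, Iff.rfl⟩,
    fun hmn => ⟨⟨fun h v hv => lt_norm_of_lt_norm_adjoint (by simp [hmn]) h hv,
      fun h w hw => ?_⟩, Iff.rfl⟩⟩
  · exact norm_lt_of_norm_adjoint_lt (H := H.adjoint)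
      (by simpa only [LinearMap.adjoint_adjoint] using h) hw
  · exact lt_norm_of_lt_norm_adjoint (H := H.adjoint) (by simp [hmn])
      (by simpa only [LinearMap.adjoint_adjoint] using h) hw
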